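/- **Setting.** Let $m\ge 1$, let $a_1,\dots,a_m\in\mathbb R^n$ be nonzero and $b_1,\dots,b_m\in\mathbb R$. Put $X_i=\{x:\langle a_i,x\rangle-b_i\le 0\}$, $X=\bigcap_{i=1}^m X_i$, $\alpha_{\min}=\min_i\|a_i\|$, $\alpha_{\max}=\max_i\|a_i\|$, and let $\Pi_X$ be the Euclidean projection on $X$. Assume that for some $\varepsilon>0$ there is $\bar x$ with $\langle a_i,\bar x\rangle-b_i\le-\varepsilon$ for all $i$. Let $\beta>0$ be a Hoffman constant of $a_1,\dots,a_m$: for all right-hand sides $b'\in\mathbb R^m$ whose system $\langle a_i,x\rangle\le b_i'$ $(i=1,\dots,m)$ is feasible, the distance of any $x\in\mathbb R^n$ to its solution set is at most $\beta$ times the sum of the distances of $x$ to the $m$ half-spaces. Let $f:\mathbb R^n\to\mathbb R$ be differentiable with $L_f$-Lipschitz gradient, $L_f>0$. For $\gamma,\delta>0$ let $$h_\delta(x;a,b)=\begin{cases}\frac{\langle a,x\rangle-b}{\|a\|},&\langle a,x\rangle-b>\delta,\\ \frac{(\langle a,x\rangle-b+\delta)^2}{4\delta\|a\|},&-\delta\le\langle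 a,x\rangle-b\le\delta,\\ 0,&\langle a,x\rangle-b<-\delta,\end{cases}\qquad F_{\gamma\delta}(x)=f(x)+\frac\gamma m\sum_{i=1}^m h_\delta(x;a_i,b_i),$$ and let $X^*_{\gamma\delta}$ be the set of minimizers of $F_{\gamma\delta}$ over $\mathbb R^n$. For $c>0$ let $R(c,\varepsilon)$ be a radius such that, for all $\gamma'>0$ and $0<\delta'\le\varepsilon$ with $\gamma'\delta'\le c$ and all $x\in X^*_{\gamma'\delta'}$, the ball of radius $R(c,\varepsilon)$ about the origin contains $\Pi_X[x]$ and, if $x\notin X$, every $z\in X$ with $h_{\delta'}(z;a_j,b_j)=0$ for all $j$ and $\|x-z\|\le\|x-\Pi_X[x]\|+\beta m\delta'/\alpha_{\min}$. Let $L(c,\varepsilon)=\max\{\|s\|: s\in\partial f(x),\ \|x\|\le R(c,\varepsilon)\}$. For $\kappa>0$ call $(\gamma,\delta)$ *$\kappa$-admissible* if $\gamma>0$ and $$0<\delta<\min\Big\{\varepsilon,\frac{16\alpha_{\min}^2}{\beta^2m^2}\Big\},\qquad \Gamma\le\gamma\le\frac{\kappa}{\delta},\qquad \Gamma=\max\Big\{L\Big(\frac1{m\beta}-\frac{\sqrt\delta}{4\alpha_{\min}}\Big)^{-1},\,4mL\alpha_{\max}\Big(\frac1{\sqrt\delta}+\frac{\beta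 m}{\alpha_{\min}}\Big)\Big\},$$ where $L=L(c,\varepsilon)$ for some $c>\kappa$ (and some radius $R(c,\varepsilon)$ as above). SAGA for the penalized problem with step size $\alpha>0$, started at $x^0\in\mathbb R^n$, puts $\phi_i^0=x^0$ for all $i$ and $G_i=\nabla f+\gamma\nabla h_\delta(\cdot;a_i,b_i)$; in step $t\ge0$ it picks $j_t$ uniformly from $\{1,\dots,m\}$, independently of the other picks, and sets $$x^{t+1}=x^t-\alpha\Big[G_{j_t}(x^t)-G_{j_t}(\phi^t_{j_t})+\frac1m\sum_{i=1}^mG_i(\phi_i^t)\Big],\qquad \phi^{t+1}_{j_t}=x^t,\qquad \phi_i^{t+1}=\phi_i^t\ (i\ne j_t).$$ **Theorem.** Let $\delta^0>0$. (a) Let $f$ be strongly convex with constant $\mu_f>0$, let $x^*$ be the minimizer of $f$ over $X$, let $(\gamma,\delta)$ be $2\mu_f\alpha_{\min}\delta^0$-admissible, and let $\alpha=\frac{1}{2(\mu_fm+L_f+\frac{\gamma\alpha_{\max}}{2\delta})}$. With $q_\gamma=1-\frac{\mu_f}{2(\mu_fm+L_f+\frac{\gamma\alpha_{\max}}{2\delta})}$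 there is a constant $C$ such that for all $t\ge 0$ $$\mathbb E\|x^t-\Pi_X[x^t]\|^2\le C\,q_\gamma^t,\qquad \mathbb E\|x^t-x^*\|^2\le C\,q_\gamma^t+2\delta^0 .$$ (b) Let $f$ be convex with bounded level sets, let $f^*=\min_Xf$, let $(\gamma,\delta)$ be $4\alpha_{\min}\delta^0$-admissible, and let $\alpha=\frac{1}{3(L_f+\frac{\gamma\alpha_{\max}}{2\delta})}$. Put $\bar x^t=\frac1t\sum_{k=1}^tx^k$. Then there is a constant $C$ such that for all $t\ge1$ $$\mathbb E[f(\bar x^t)]-f^*\le C\,\frac{4m}{t}+2\delta^0,$$ and for every $\tilde\varepsilon>0$ there is $T>0$ such that $-\gamma\tilde\varepsilon\le\mathbb E[f(\bar x^t)]-f^*$ for all $t>T$. -/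

import Mathlib

open MeasureTheory ProbabilityTheory

noncomputable section

namespace PenSAGA

/-- `ℝⁿ` with its Euclidean inner product and norm. -/
abbrev E (n : ℕ) : Type := EuclideanSpace ℝ (Fin n)

variable {n m : ℕ}

/-- The half-space `{x | ⟨a, x⟩ - b ≤ 0}`. -/
def halfSpace (a : E n) (b : ℝ) : Set (E n) := {x | inner ℝ a x - b ≤ 0}

/-- The feasible set `X`, the intersection of the half-spaces. -/
def feasible (a : Fin m → E n) (b : Fin m → ℝ) : Set (E n) := ⋂ i, halfSpace (a i) (b i)

/-- `α_min = min_j ‖a_j‖` (used only for `m ≥ 1`). -/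
def alphaMin (a : Fin m → E n) : ℝ := ⨅ j, ‖a j‖

/-- `α_max = max_j ‖a_j‖` (used only for `m ≥ 1`). -/
def alphaMax (a : Fin m → E n) : ℝ := ⨆ j, ‖a j‖

open Classical in
/-- A nearest point of `Y` to `x`; for a nonempty closed convex `Y` it exists and is unique, and
this is the Euclidean projection of `x` on `Y`. -/
def proj (Y : Set (E n)) (x : E n) : E n :=
  if h : ∃ p ∈ Y, ‖x - p‖ = Metric.infDist x Y then h.choose else x

/-- The one-sided Huber penalty `h_δ(x; a, b)`. -/
def penalty (δ : ℝ) (a : E n) (b : ℝ) (x : E n) : ℝ :=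
  if δ < inner ℝ a x - b then (inner ℝ a x - b) / ‖a‖
  else if -δ ≤ inner ℝ a x - b then (inner ℝ a x - b + δ) ^ 2 / (4 * δ * ‖a‖)
  else 0

/-- The penalized objective `F_{γδ}(x) = f(x) + (γ/m) ∑ h_δ(x; a_i, b_i)`. -/
def penObj (f : E n → ℝ) (a : Fin m → E n) (b : Fin m → ℝ) (γ δ : ℝ) (x : E n) : ℝ :=
  f x + γ / m * ∑ i, penalty δ (a i) (b i) x

/-- The solution set `X*_{γδ}` of the penalized problem. -/
def penSolutions (f : E n → ℝ) (a : Fin m → E n) (b : Fin m → ℝ) (γ δ : ℝ) : Set (E n) :=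
  {x | ∀ z, penObj f a b γ δ x ≤ penObj f a b γ δ z}

/-- `β = β(a_1, …, a_m) > 0` is a Hoffman constant: it depends on the normals only, so the error
bound holds for all right-hand sides for which the system is feasible. -/
def IsHoffmanConst (a : Fin m → E n) (β : ℝ) : Prop :=
  0 < β ∧ ∀ b : Fin m → ℝ, (feasible a b).Nonempty → ∀ x : E n,
    Metric.infDist x (feasible a b) ≤ β * ∑ i, Metric.infDist x (halfSpace (a i) (b i))

/-- The subdifferential of `f` at `x`. -/
def subdiff (f : E n → ℝ) (x : E n) : Set (E n) := {s | ∀ y, f x + inner ℝ s (y - x) ≤ f y}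

/-- `R` is a radius `R(c, ε)`: uniformly in `γ > 0`, `0 < δ ≤ ε` with `γ δ ≤ c`, the ball of radius
`R` about the origin contains the projections on `X` of the penalized solutions `x` and, for
infeasible `x`, all unpenalized feasible points `z` with
`‖x - z‖ ≤ ‖x - Π_X x‖ + β m δ / α_min`. -/
def IsRadius (f : E n → ℝ) (a : Fin m → E n) (b : Fin m → ℝ) (β ε c R : ℝ) : Prop :=
  ∀ γ δ : ℝ, 0 < γ → 0 < δ → δ ≤ ε → γ * δ ≤ c → ∀ x ∈ penSolutions f a b γ δ,
    ‖proj (feasible a b) x‖ ≤ R ∧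
    (x ∉ feasible a b → ∀ z ∈ feasible a b,
      (∀ j, penalty δ (a j) (b j) z = 0) →
      ‖x - z‖ ≤ ‖x - proj (feasible a b) x‖ + β * m * δ / alphaMin a → ‖z‖ ≤ R)

/-- `L = max {‖s‖ | s ∈ ∂f(x), ‖x‖ ≤ R}`. -/
def subgradBound (f : E n → ℝ) (R : ℝ) : ℝ :=
  sSup {r | ∃ x s : E n, ‖x‖ ≤ R ∧ s ∈ subdiff f x ∧ r = ‖s‖}

/-- The threshold `Γ` for the penalty weight. -/
def Gam (a : Fin m → E n) (β δ L : ℝ) : ℝ :=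
  max (L * (1 / (m * β) - √δ / (4 * alphaMin a))⁻¹)
    (4 * m * L * alphaMax a * (1 / √δ + β * m / alphaMin a))

/-- The admissible choices of `γ, δ` with `γ δ` bounded by `κ`:
`0 < δ < min {ε, 16 α_min² / (β² m²)}` and `Γ ≤ γ ≤ κ / δ`, where `Γ` is formed with
`L = L(c, ε)` for some `c > κ`. -/
def AdmissibleParams (f : E n → ℝ) (a : Fin m → E n) (b : Fin m → ℝ) (β ε κ γ δ : ℝ) : Prop :=
  0 < γ ∧ 0 < δ ∧ δ < min ε (16 * alphaMin a ^ 2 / (β ^ 2 * m ^ 2)) ∧ γ ≤ κ / δ ∧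
    ∃ c R : ℝ, κ < c ∧ IsRadius f a b β ε c R ∧ Gam a β δ (subgradBound f R) ≤ γ

/-- `f` is differentiable with `L`-Lipschitz gradient. -/
def HasLipschitzGradient (f : E n → ℝ) (L : ℝ) : Prop :=
  Differentiable ℝ f ∧ ∀ x y, ‖gradient f x - gradient f y‖ ≤ L * ‖x - y‖

/-- `∇f(x) + γ ∇h_δ(x; a_i, b_i)`, the gradient of the `i`-th component function. -/
def compGrad (f : E n → ℝ) (a : Fin m → E n) (b : Fin m → ℝ) (γ δ : ℝ) (i : Fin m) (x : E n) :
    E n :=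
  gradient f x + γ • gradient (penalty δ (a i) (b i)) x

/-- One SAGA step with component gradients `G` and step size `α` from the state `(x, φ)`, when the
index `j` is picked. -/
def sagaStep (G : Fin m → E n → E n) (α : ℝ) (s : E n × (Fin m → E n)) (j : Fin m) :
    E n × (Fin m → E n) :=
  (s.1 - α • (G j s.1 - G j (s.2 j) + (1 / (m : ℝ)) • ∑ i, G i (s.2 i)),
    Function.update s.2 j s.1)

/-- The state `(x^t, φ^t)` of SAGA when the picked indices are `j 0, j 1, …`, started at
`x^0 = φ_i^0 = x0`. -/
def sagaState (G : Fin m → E n → E n) (α : ℝ) (x0 : E n) (j : ℕ → Fin m) :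
    ℕ → E n × (Fin m → E n)
  | 0 => (x0, fun _ => x0)
  | t + 1 => sagaStep G α (sagaState G α x0 j t) (j t)

/-- The iterate `x^t` of SAGA applied to the penalized problem. -/
def iter (f : E n → ℝ) (a : Fin m → E n) (b : Fin m → ℝ) (γ δ α : ℝ) (x0 : E n)
    (j : ℕ → Fin m) (t : ℕ) : E n :=
  (sagaState (compGrad f a b γ δ) α x0 j t).1

/-- The average `(1/t) ∑_{k=1}^t x^k` of the iterates. -/
def avgIter (f : E n → ℝ) (a : Fin m → E n) (b : Fin m → ℝ) (γ δ α : ℝ) (x0 : E n)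
    (j : ℕ → Fin m) (t : ℕ) : E n :=
  (1 / (t : ℝ)) • ∑ k ∈ Finset.Icc 1 t, iter f a b γ δ α x0 j k

/-- The random indices `J 0, J 1, …` are independent and uniform on `{1, …, m}`. -/
structure IsUniformSampling {Ω : Type*} [MeasurableSpace Ω] (P : Measure Ω)
    (J : ℕ → Ω → Fin m) : Prop where
  measurable : ∀ t, Measurable (J t)
  indep : iIndepFun J P
  uniform : ∀ t i, P.real (J t ⁻¹' {i}) = 1 / m

end PenSAGA

end

/-!
By Hoffman's error bound, every minimizer `z` of the penalized objective is feasible when `(γ, δ)`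
is admissible: an infeasible minimizer would carry so large a penalty that moving to a nearby
unpenalized feasible point pays off. On the feasible set the penalty is at most `γ δ / (4 α_min)`,
so `z` solves the constrained problem up to an error governed by `δ₀`.

The components `f + γ h_δ(·; a_i, b_i)` are convex with slopes of Lipschitz constant
`L_f + γ α_max / (2 δ)`, so SAGA finds `z` at its usual rates: a Lyapunov function made of
`‖x - z‖ ^ 2` and the mean Bregman distance of the stored points from `z` contracts in
expectation (a), or decreases by at least a multiple of the optimality gap (b).
-/

namespace PenSAGA

section Mean

variable {ι W : Type*} [Fintype ι] [AddCommGroup W] [Module ℝ W]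

/-- The mean of a finite family of vectors: the expectation at an index that is picked uniformly.
(`Finset.expect` would ask for a second module structure, over `ℚ≥0`.) -/
noncomputable def mean (u : ι → W) : W := (1 / (Fintype.card ι : ℝ)) • ∑ i, u i

theorem mean_fin {m : ℕ} (u : Fin m → W) : mean u = (1 / (m : ℝ)) • ∑ i, u i := by
  rw [mean, Fintype.card_fin]

theorem mean_Icc (u : ℕ → W) (t : ℕ) :
    (mean fun k : Finset.Icc 1 t => u k) = (1 / (t : ℝ)) • ∑ k ∈ Finset.Icc 1 t, u k := by
  rw [mean, Finset.sum_coe_sort (Finset.Icc 1 t) u, Fintype.card_coe, Nat.card_Icc,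
    Nat.add_sub_cancel]

theorem mean_add (u w : ι → W) : mean (fun i => u i + w i) = mean u + mean w := by
  simp only [mean, Finset.sum_add_distrib, smul_add]

theorem mean_sub (u w : ι → W) : mean (fun i => u i - w i) = mean u - mean w := by
  simp only [mean, Finset.sum_sub_distrib, smul_sub]

theorem mean_smul (c : ℝ) (u : ι → W) : mean (fun i => c • u i) = c • mean u := by
  simp only [mean, ← Finset.smul_sum, smul_comm c]

theorem mean_mul (c : ℝ) (u : ι → ℝ) : mean (fun i => c * u i) = c * mean u :=
  mean_smul c u

@[simp]
theorem mean_const [Nonempty ι] (w : W) : mean (fun _ : ι => w) = w := by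
  rw [mean, Finset.sum_const, Finset.card_univ, ← Nat.cast_smul_eq_nsmul ℝ, smul_smul,
    one_div_mul_cancel (Nat.cast_ne_zero.2 Fintype.card_ne_zero), one_smul]

theorem mean_mono {u w : ι → ℝ} (h : ∀ i, u i ≤ w i) : mean u ≤ mean w :=
  smul_le_smul_of_nonneg_left (Finset.sum_le_sum fun i _ => h i) (by positivity)

theorem mean_nonneg {u : ι → ℝ} (h : ∀ i, 0 ≤ u i) : 0 ≤ mean u :=
  smul_nonneg (by positivity) (Finset.sum_nonneg fun i _ => h i)

theorem mean_mean_update {S : Type*} [DecidableEq ι] [Nonempty ι] (B : ι → S → ℝ) (φ : ι → S)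
    (x : S) :
    mean (fun j => mean fun i => B i (Function.update φ j x i)) =
      (1 - 1 / (Fintype.card ι : ℝ)) * mean (fun i => B i (φ i)) +
        1 / (Fintype.card ι : ℝ) * mean fun i => B i x := by
  have hcard : (Fintype.card ι : ℝ) ≠ 0 := Nat.cast_ne_zero.2 Fintype.card_ne_zero
  have hsum (j : ι) : ∑ i, B i (Function.update φ j x i) =
      ∑ i, B i (φ i) + (B j x - B j (φ j)) := by
    simp only [Function.apply_update B]
    rw [Finset.sum_update_of_mem (Finset.mem_univ j), ← Finset.erase_eq,
      ← Finset.add_sum_erase _ (fun i => B i (φ i)) (Finset.mem_univ j)]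
    ring
  simp only [mean, hsum, smul_eq_mul, ← Finset.mul_sum, Finset.sum_add_distrib,
    Finset.sum_sub_distrib, Finset.sum_const, Finset.card_univ, nsmul_eq_mul]
  field_simp
  ring

variable {V : Type*} [NormedAddCommGroup V] [InnerProductSpace ℝ V]

theorem inner_mean_left (u : ι → V) (z : V) :
    inner ℝ (mean u) z = mean fun i => inner ℝ (u i) z := by
  simp only [mean, real_inner_smul_left, sum_inner, smul_eq_mul]

theorem inner_mean_right (z : V) (u : ι → V) :
    inner ℝ z (mean u) = mean fun i => inner ℝ z (u i) := by
  simp only [mean, real_inner_smul_right, inner_sum, smul_eq_mul]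

theorem mean_norm_add_sq [Nonempty ι] (p : V) (u : ι → V) :
    mean (fun i => ‖p + u i‖ ^ 2) =
      ‖p‖ ^ 2 + 2 * inner ℝ p (mean u) + mean fun i => ‖u i‖ ^ 2 := by
  simp only [norm_add_sq_real, mean_add, mean_mul, mean_const, inner_mean_right]

theorem mean_norm_sub_mean_sq [Nonempty ι] (u : ι → V) :
    mean (fun i => ‖u i - mean u‖ ^ 2) = mean (fun i => ‖u i‖ ^ 2) - ‖mean u‖ ^ 2 := by
  have h := mean_norm_add_sq (-mean u) u
  simp only [neg_add_eq_sub, inner_neg_left, norm_neg, real_inner_self_eq_norm_sq] at h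
  linarith

theorem norm_sub_sq_le_of_pos {β : ℝ} (hβ : 0 < β) (p q : V) :
    ‖p - q‖ ^ 2 ≤ (1 + β) * ‖p‖ ^ 2 + (1 + 1 / β) * ‖q‖ ^ 2 := by
  have h : 0 ≤ 1 / β * ‖β • p + q‖ ^ 2 := by positivity
  rw [norm_add_sq_real, real_inner_smul_left, norm_smul, mul_pow, Real.norm_eq_abs, sq_abs] at h
  have e : 1 / β * (β ^ 2 * ‖p‖ ^ 2 + 2 * (β * inner ℝ p q) + ‖q‖ ^ 2) =
      β * ‖p‖ ^ 2 + 2 * inner ℝ p q + 1 / β * ‖q‖ ^ 2 := by field_simp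
  rw [norm_sub_sq_real]
  linarith

theorem mean_norm_varianceReduced_sq_le [Nonempty ι] {β : ℝ} (hβ : 0 < β) (u w : ι → V) :
    mean (fun j => ‖u j - w j + mean w‖ ^ 2) ≤
      (1 + 1 / β) * mean (fun j => ‖w j‖ ^ 2) + (1 + β) * mean (fun j => ‖u j‖ ^ 2) -
        β * ‖mean u‖ ^ 2 := by
  have hcentre : mean (fun j => ‖u j - w j + mean w‖ ^ 2) =
      ‖mean u‖ ^ 2 + mean fun j => ‖(u j - mean u) - (w j - mean w)‖ ^ 2 := by
    have h := mean_norm_add_sq (mean u) fun j => (u j - mean u) - (w j - mean w)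
    simp only [mean_sub, mean_const, sub_self, inner_zero_right, mul_zero, add_zero] at h
    rw [← h]
    congr! 4 with j
    abel
  have hyoung : mean (fun j => ‖(u j - mean u) - (w j - mean w)‖ ^ 2) ≤
      (1 + β) * (mean (fun j => ‖u j‖ ^ 2) - ‖mean u‖ ^ 2) +
        (1 + 1 / β) * (mean (fun j => ‖w j‖ ^ 2) - ‖mean w‖ ^ 2) := by
    rw [← mean_norm_sub_mean_sq, ← mean_norm_sub_mean_sq, ← mean_mul, ← mean_mul, ← mean_add]
    exact mean_mono fun j => norm_sub_sq_le_of_pos hβ _ _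
  have hw : 0 ≤ (1 + 1 / β) * ‖mean w‖ ^ 2 := by positivity
  linarith

end Mean

section QuadraticBounds

variable {V : Type*} [NormedAddCommGroup V] [InnerProductSpace ℝ V]

/-- The Bregman distance of `y` from `x` for a function `g` with slope field `G`: the error at `y`
of the linearization of `g` at `x`. -/
noncomputable def bregman (g : V → ℝ) (G : V → V) (x y : V) : ℝ :=
  g y - g x - inner ℝ (G x) (y - x)

/-- The Bregman distances of `g` with slope field `G` lie between `μ / 2 * ‖y - x‖ ^ 2` and
`L / 2 * ‖y - x‖ ^ 2`. For `0 ≤ μ` this says that `G` is the gradient of `g` and that `g` is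
`μ`-strongly convex and `L`-smooth. -/
structure HasQuadraticBounds (g : V → ℝ) (G : V → V) (μ L : ℝ) : Prop where
  lower : ∀ x y, μ / 2 * ‖y - x‖ ^ 2 ≤ bregman g G x y
  upper : ∀ x y, bregman g G x y ≤ L / 2 * ‖y - x‖ ^ 2

theorem bregman_add (g h : V → ℝ) (G H : V → V) (x y : V) :
    bregman (fun x => g x + h x) (fun x => G x + H x) x y = bregman g G x y + bregman h H x y := by
  simp only [bregman, inner_add_left]
  ring

theorem bregman_const_mul (c : ℝ) (g : V → ℝ) (G : V → V) (x y : V) :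
    bregman (fun x => c * g x) (fun x => c • G x) x y = c * bregman g G x y := by
  simp only [bregman, real_inner_smul_left]
  ring

theorem bregman_mean {ι : Type*} [Fintype ι] (g : ι → V → ℝ) (G : ι → V → V) (x y : V) :
    bregman (fun x => mean fun i => g i x) (fun x => mean fun i => G i x) x y =
      mean fun i => bregman (g i) (G i) x y := by
  simp only [bregman, mean_sub, inner_mean_left]

namespace HasQuadraticBounds

variable {g h : V → ℝ} {G H : V → V} {μ ν L M : ℝ}

theorem mono (hg : HasQuadraticBounds g G μ L) (hμ : ν ≤ μ) (hL : L ≤ M) :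
    HasQuadraticBounds g G ν M where
  lower x y := le_trans (by gcongr) (hg.lower x y)
  upper x y := le_trans (hg.upper x y) (by gcongr)

theorem add (hg : HasQuadraticBounds g G μ L) (hh : HasQuadraticBounds h H ν M) :
    HasQuadraticBounds (fun x => g x + h x) (fun x => G x + H x) (μ + ν) (L + M) where
  lower x y := by
    rw [bregman_add, add_div, add_mul]
    exact add_le_add (hg.lower x y) (hh.lower x y)
  upper x y := by
    rw [bregman_add, add_div, add_mul]
    exact add_le_add (hg.upper x y) (hh.upper x y)

theorem const_mul (hg : HasQuadraticBounds g G μ L) {c : ℝ} (hc : 0 ≤ c) :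
    HasQuadraticBounds (fun x => c * g x) (fun x => c • G x) (c * μ) (c * L) where
  lower x y := by
    rw [bregman_const_mul, mul_div_assoc, mul_assoc]
    exact mul_le_mul_of_nonneg_left (hg.lower x y) hc
  upper x y := by
    rw [bregman_const_mul, mul_div_assoc, mul_assoc]
    exact mul_le_mul_of_nonneg_left (hg.upper x y) hc

theorem mean {ι : Type*} [Fintype ι] [Nonempty ι] {g : ι → V → ℝ} {G : ι → V → V}
    (hg : ∀ i, HasQuadraticBounds (g i) (G i) μ L) :
    HasQuadraticBounds (fun x => mean fun i => g i x) (fun x => mean fun i => G i x) μ L where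
  lower x y := by
    rw [bregman_mean, ← mean_const (ι := ι) (μ / 2 * ‖y - x‖ ^ 2)]
    exact mean_mono fun i => (hg i).lower x y
  upper x y := by
    rw [bregman_mean, ← mean_const (ι := ι) (L / 2 * ‖y - x‖ ^ 2)]
    exact mean_mono fun i => (hg i).upper x y

theorem le_of_ne (hg : HasQuadraticBounds g G μ L) {x y : V} (hxy : x ≠ y) : μ ≤ L := by
  have hpos : 0 < ‖y - x‖ ^ 2 := pow_pos (norm_pos_iff.2 (sub_ne_zero.2 hxy.symm)) 2
  exact (div_le_div_iff_of_pos_right two_pos).1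
    (le_of_mul_le_mul_right ((hg.lower x y).trans (hg.upper x y)) hpos)

theorem bregman_nonneg (hg : HasQuadraticBounds g G μ L) (hμ : 0 ≤ μ) (x y : V) :
    0 ≤ bregman g G x y :=
  le_trans (by positivity) (hg.lower x y)

theorem hasGradientAt [CompleteSpace V] (hg : HasQuadraticBounds g G μ L) (hμ : 0 ≤ μ) (x : V) :
    HasGradientAt g (G x) x := by
  rw [hasGradientAt_iff_isLittleO]
  have hbound : (fun y => bregman g G x y) =O[nhds x] fun y => ‖y - x‖ ^ 2 := by
    refine .of_bound (L / 2) (.of_forall fun y => ?_)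
    simpa [abs_of_nonneg (hg.bregman_nonneg hμ x y)] using hg.upper x y
  refine hbound.trans_isLittleO ?_
  have hsub : Filter.Tendsto (fun y => y - x) (nhds x) (nhds 0) :=
    tendsto_sub_nhds_zero_iff.2 Filter.tendsto_id
  exact (Asymptotics.isLittleO_norm_pow_id one_lt_two).comp_tendsto hsub

theorem continuous [CompleteSpace V] (hg : HasQuadraticBounds g G μ L) (hμ : 0 ≤ μ) :
    Continuous g :=
  continuous_iff_continuousAt.2 fun x => (hg.hasGradientAt hμ x).continuousAt

theorem slope_eq_zero [CompleteSpace V] (hg : HasQuadraticBounds g G μ L) (hμ : 0 ≤ μ) {x : V}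
    (hx : ∀ y, g x ≤ g y) : G x = 0 := by
  have hmin : IsLocalMin g x := .of_forall hx
  simpa using hmin.hasFDerivAt_eq_zero (hg.hasGradientAt hμ x).hasFDerivAt

theorem map_mean_le (hg : HasQuadraticBounds g G μ L) (hμ : 0 ≤ μ) {ι : Type*} [Fintype ι]
    [Nonempty ι] (x : ι → V) : g (PenSAGA.mean x) ≤ PenSAGA.mean fun i => g (x i) := by
  have h := mean_nonneg fun i => hg.bregman_nonneg hμ (PenSAGA.mean x) (x i)
  simp only [bregman, mean_sub, mean_const, ← inner_mean_right, sub_self, inner_zero_right,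
    sub_zero] at h
  linarith

/-- The Polyak–Łojasiewicz inequality. -/
theorem two_mul_gap_le (hg : HasQuadraticBounds g G μ L) (hμ : 0 ≤ μ) (x y : V) :
    2 * μ * (g x - g y) ≤ ‖G x‖ ^ 2 := by
  have hlower := mul_le_mul_of_nonneg_left (hg.lower x y) hμ
  have hsq : 0 ≤ ‖G x + μ • (y - x)‖ ^ 2 := by positivity
  rw [norm_add_sq_real, real_inner_smul_right, norm_smul, mul_pow, Real.norm_eq_abs,
    sq_abs] at hsq
  rw [bregman] at hlower
  linarith

theorem norm_sub_sub_smul_sq_le (hg : HasQuadraticBounds g G μ L) (hL : μ < L) (x y : V) :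
    ‖G x - G y - μ • (x - y)‖ ^ 2 ≤
      2 * (L - μ) * (bregman g G x y - μ / 2 * ‖y - x‖ ^ 2) := by
  have hK : 0 < L - μ := sub_pos.2 hL
  set D := G x - G y - μ • (x - y) with hD
  -- The point `y + s • D` minimizes the upper bound at `y` minus the lower bound at `x`.
  set s := 1 / (L - μ) with hs
  have hlower := hg.lower x (y + s • D)
  have hupper := hg.upper y (y + s • D)
  have hGy : G y = G x - μ • (x - y) - D := by rw [hD]; abel
  rw [bregman, add_sub_right_comm, norm_add_sq_real, inner_add_right] at hlower
  rw [bregman, add_sub_cancel_left, hGy] at hupper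
  simp only [real_inner_smul_right, inner_sub_left, real_inner_smul_left, norm_smul, mul_pow,
    Real.norm_eq_abs, sq_abs, real_inner_self_eq_norm_sq] at hlower hupper
  have hsD : s * ‖D‖ ^ 2 - (L - μ) / 2 * (s ^ 2 * ‖D‖ ^ 2) = ‖D‖ ^ 2 / (2 * (L - μ)) := by
    rw [hs]
    field_simp
    ring
  rw [← div_le_iff₀' (by positivity), ← hsD, bregman]
  linarith

theorem interpolation (hg : HasQuadraticBounds g G μ L) (hL : μ < L) (hL0 : 0 < L) (x y : V) :
    (L - μ) / L * (g x - g y) + 1 / (2 * L) * ‖G x - G y‖ ^ 2 + μ / 2 * ‖x - y‖ ^ 2 ≤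
      inner ℝ (G x) (x - y) - μ / L * inner ℝ (G y) (x - y) := by
  have h := hg.norm_sub_sub_smul_sq_le hL x y
  rw [bregman, ← neg_sub x y, inner_neg_right, norm_neg, norm_sub_sq_real, real_inner_smul_right,
    norm_smul, mul_pow, Real.norm_eq_abs, sq_abs, inner_sub_left] at h
  rw [← sub_nonneg, ← mul_nonneg_iff_of_pos_left (by positivity : 0 < 2 * L)]
  field_simp
  linarith

theorem norm_sub_sq_le (hg : HasQuadraticBounds g G μ L) (hμ : 0 ≤ μ) (hL : 0 < L) (x y : V) :
    ‖G x - G y‖ ^ 2 ≤ 2 * L * bregman g G y x := by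
  simpa [norm_sub_rev (G y)] using (hg.mono hμ le_rfl).norm_sub_sub_smul_sq_le hL y x

theorem norm_sub_le (hg : HasQuadraticBounds g G μ L) (hμ : 0 ≤ μ) (hL : 0 < L) (x y : V) :
    ‖G x - G y‖ ≤ L * ‖x - y‖ := by
  refine le_of_sq_le_sq ?_ (by positivity)
  calc ‖G x - G y‖ ^ 2 ≤ 2 * L * bregman g G y x := hg.norm_sub_sq_le hμ hL x y
    _ ≤ 2 * L * (L / 2 * ‖x - y‖ ^ 2) := by
        gcongr
        exact hg.upper y x
    _ = (L * ‖x - y‖) ^ 2 := by ring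

open Filter Bornology in
theorem isBounded_sublevel (hg : HasQuadraticBounds g G μ L) (hμ : 0 < μ) (r : ℝ) :
    IsBounded {x | g x ≤ r} := by
  have hbound (x : V) : ‖x‖ * (μ / 2 * ‖x‖ - ‖G 0‖) + g 0 ≤ g x := by
    have hlower := hg.lower 0 x
    have hinner := neg_le_of_abs_le (abs_real_inner_le_norm (G 0) x)
    rw [bregman, sub_zero] at hlower
    linarith
  have hnorm := tendsto_norm_cobounded_atTop (E := V)
  have hcoercive : Tendsto g (cobounded V) atTop :=
    tendsto_atTop_mono hbound (tendsto_atTop_add_const_right _ _ (hnorm.atTop_mul_atTop₀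
      (tendsto_atTop_add_const_right _ _ (hnorm.const_mul_atTop (half_pos hμ)))))
  rw [isBounded_def]
  filter_upwards [hcoercive.eventually_gt_atTop r] with x hx using not_le.2 hx

end HasQuadraticBounds

theorem bregman_gradient_le [CompleteSpace V] {g : V → ℝ} {L : ℝ} (hg : Differentiable ℝ g)
    (hL : ∀ x y, ‖gradient g x - gradient g y‖ ≤ L * ‖x - y‖) (x y : V) :
    bregman g (gradient g) x y ≤ L / 2 * ‖y - x‖ ^ 2 := by
  set d := y - x with hd
  have hder (s : ℝ) : HasDerivAt (fun s : ℝ => g (x + s • d))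
      (inner ℝ (gradient g (x + s • d)) d) s := by
    have hline : HasDerivAt (fun s : ℝ => x + s • d) d s := by
      simpa using ((hasDerivAt_id s).smul_const d).const_add x
    exact ((hg (x + s • d)).hasGradientAt.hasFDerivAt.comp_hasDerivAt s hline).congr_deriv
      (by simp)
  have hder' (s : ℝ) : HasDerivAt
      (fun s : ℝ => g x + s * inner ℝ (gradient g x) d + s ^ 2 * (L / 2 * ‖d‖ ^ 2))
      (inner ℝ (gradient g x) d + 2 * s * (L / 2 * ‖d‖ ^ 2)) s := by
    have h := (((hasDerivAt_id s).mul_const (inner ℝ (gradient g x) d)).const_add (g x)).add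
      (((hasDerivAt_id s).pow 2).mul_const (L / 2 * ‖d‖ ^ 2))
    exact h.congr_deriv (by simp)
  have hslope (s : ℝ) (hs : s ∈ Set.Ico (0 : ℝ) 1) : inner ℝ (gradient g (x + s • d)) d ≤
      inner ℝ (gradient g x) d + 2 * s * (L / 2 * ‖d‖ ^ 2) := by
    have hnorm := hL (x + s • d) x
    rw [add_sub_cancel_left, norm_smul, Real.norm_eq_abs, abs_of_nonneg hs.1] at hnorm
    have hinner := (real_inner_le_norm _ d).trans
      (mul_le_mul_of_nonneg_right hnorm (norm_nonneg d))
    rw [inner_sub_left] at hinner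
    linarith
  have h := image_le_of_deriv_right_le_deriv_boundary
    (fun s _ => (hder s).continuousAt.continuousWithinAt)
    (fun s _ => (hder s).hasDerivWithinAt) (by simp)
    (fun s _ => (hder' s).continuousAt.continuousWithinAt)
    (fun s _ => (hder' s).hasDerivWithinAt) hslope (Set.right_mem_Icc.2 zero_le_one)
  rw [one_smul, hd, add_sub_cancel] at h
  rw [bregman]
  linarith

open Filter Topology in
theorem le_bregman_gradient [CompleteSpace V] {g : V → ℝ} {μ : ℝ}
    (hg : StrongConvexOn Set.univ μ g) {x : V} (hx : DifferentiableAt ℝ g x) (y : V) :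
    μ / 2 * ‖y - x‖ ^ 2 ≤ bregman g (gradient g) x y := by
  have hslope : Tendsto (fun s : ℝ => s⁻¹ • (g (x + s • (y - x)) - g x)) (𝓝[>] 0)
      (𝓝 (inner ℝ (gradient g x) (y - x))) := by
    simpa using (hx.hasGradientAt.hasFDerivAt.hasLineDerivAt (y - x)).tendsto_slope_zero_right
  have hbound : Tendsto (fun s : ℝ => g y - g x - (1 - s) * (μ / 2 * ‖y - x‖ ^ 2)) (𝓝[>] 0)
      (𝓝 (g y - g x - (1 - 0) * (μ / 2 * ‖y - x‖ ^ 2))) :=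
    (Continuous.tendsto (by fun_prop) 0).mono_left nhdsWithin_le_nhds
  have hle : ∀ᶠ s : ℝ in 𝓝[>] 0, s⁻¹ • (g (x + s • (y - x)) - g x) ≤
      g y - g x - (1 - s) * (μ / 2 * ‖y - x‖ ^ 2) := by
    filter_upwards [Ioo_mem_nhdsGT one_pos] with s hs
    have h := hg.2 (Set.mem_univ x) (Set.mem_univ y) (sub_nonneg.2 hs.2.le) hs.1.le (by ring)
    rw [show (1 - s) • x + s • y = x + s • (y - x) by module, norm_sub_rev x y] at h
    rw [smul_eq_mul, inv_mul_le_iff₀ hs.1]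
    simp only [smul_eq_mul] at h
    linarith
  have h := le_of_tendsto_of_tendsto hslope hbound hle
  rw [bregman]
  linarith

end QuadraticBounds

section Step

variable {n m : ℕ}

/-- The variance-reduced estimate of the mean slope at `s.1` that SAGA forms from the table `s.2`
when the index `j` is picked. -/
noncomputable def sagaDirection (G : Fin m → E n → E n) (s : E n × (Fin m → E n)) (j : Fin m) :
    E n :=
  G j s.1 - G j (s.2 j) + mean fun i => G i (s.2 i)

/-- The mean Bregman distance of the table entries from `z`. -/
noncomputable def tableGap (g : Fin m → E n → ℝ) (G : Fin m → E n → E n) (z : E n)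
    (φ : Fin m → E n) : ℝ :=
  mean fun i => bregman (g i) (G i) z (φ i)

/-- The Lyapunov function of SAGA for the minimizer `z`; the weight `c` is fitted to the step
size. -/
noncomputable def lyapunov (g : Fin m → E n → ℝ) (G : Fin m → E n → E n) (z : E n) (c : ℝ)
    (s : E n × (Fin m → E n)) : ℝ :=
  tableGap g G z s.2 + c * ‖s.1 - z‖ ^ 2

variable {g : Fin m → E n → ℝ} {G : Fin m → E n → E n} {z : E n} {μ L α β c : ℝ}

theorem sagaStep_fst (G : Fin m → E n → E n) (α : ℝ) (s : E n × (Fin m → E n)) (j : Fin m) :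
    (sagaStep G α s j).1 = s.1 - α • sagaDirection G s j := by
  rw [sagaStep, sagaDirection, mean_fin]

theorem tableGap_nonneg (hg : ∀ i, HasQuadraticBounds (g i) (G i) μ L) (hμ : 0 ≤ μ) (z : E n)
    (φ : Fin m → E n) : 0 ≤ tableGap g G z φ :=
  mean_nonneg fun i => (hg i).bregman_nonneg hμ z (φ i)

theorem mul_norm_sq_le_lyapunov (hg : ∀ i, HasQuadraticBounds (g i) (G i) μ L) (hμ : 0 ≤ μ)
    (z : E n) (c : ℝ) (s : E n × (Fin m → E n)) : c * ‖s.1 - z‖ ^ 2 ≤ lyapunov g G z c s :=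
  le_add_of_nonneg_left (tableGap_nonneg hg hμ z s.2)

theorem mean_bregman_eq (hz : mean (fun i => G i z) = 0) (x : E n) :
    mean (fun i => bregman (g i) (G i) z x) = mean (fun i => g i x) - mean fun i => g i z := by
  simp only [bregman, mean_sub, ← inner_mean_left, hz, inner_zero_left, sub_zero]

variable [NeZero m]

theorem mean_sagaDirection (G : Fin m → E n → E n) (s : E n × (Fin m → E n)) :
    mean (sagaDirection G s) = mean fun i => G i s.1 := by
  unfold sagaDirection
  rw [mean_add, mean_sub, mean_const, sub_add_cancel]

theorem mean_norm_sagaDirection_sq_le (hg : ∀ i, HasQuadraticBounds (g i) (G i) μ L)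
    (hμ : 0 ≤ μ) (hL : 0 < L) (hβ : 0 < β) (hz : mean (fun i => G i z) = 0)
    (s : E n × (Fin m → E n)) :
    mean (fun j => ‖sagaDirection G s j‖ ^ 2) ≤
      (1 + 1 / β) * (2 * L * tableGap g G z s.2) +
        (1 + β) * mean (fun j => ‖G j s.1 - G j z‖ ^ 2) -
        β * (2 * μ * (mean (fun i => g i s.1) - mean fun i => g i z)) := by
  have hvar := mean_norm_varianceReduced_sq_le hβ (fun j => G j s.1 - G j z)
    fun j => G j (s.2 j) - G j z
  simp only [mean_sub, hz, sub_zero, sub_sub_sub_cancel_right] at hvar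
  have htable : mean (fun j => ‖G j (s.2 j) - G j z‖ ^ 2) ≤ 2 * L * tableGap g G z s.2 := by
    rw [tableGap, ← mean_mul]
    exact mean_mono fun j => (hg j).norm_sub_sq_le hμ hL (s.2 j) z
  have hgap := (HasQuadraticBounds.mean hg).two_mul_gap_le hμ s.1 z
  calc mean (fun j => ‖sagaDirection G s j‖ ^ 2) ≤ _ := hvar
    _ ≤ _ := by gcongr

theorem mean_interpolation (hg : ∀ i, HasQuadraticBounds (g i) (G i) μ L) (hL : μ < L)
    (hL0 : 0 < L) (hz : mean (fun i => G i z) = 0) (x : E n) :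
    (L - μ) / L * (mean (fun i => g i x) - mean fun i => g i z) +
        1 / (2 * L) * mean (fun j => ‖G j x - G j z‖ ^ 2) + μ / 2 * ‖x - z‖ ^ 2 ≤
      inner ℝ (mean fun i => G i x) (x - z) := by
  have h := mean_mono fun i => (hg i).interpolation hL hL0 x z
  simpa only [mean_add, mean_sub, mean_mul, mean_const, ← inner_mean_left, hz, inner_zero_left,
    mul_zero, sub_zero] using h

theorem mean_norm_sagaStep_sub_sq (G : Fin m → E n → E n) (α : ℝ) (s : E n × (Fin m → E n))
    (z : E n) :
    mean (fun j => ‖(sagaStep G α s j).1 - z‖ ^ 2) =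
      ‖s.1 - z‖ ^ 2 - 2 * α * inner ℝ (mean fun i => G i s.1) (s.1 - z) +
        α ^ 2 * mean fun j => ‖sagaDirection G s j‖ ^ 2 := by
  have h := mean_norm_add_sq (s.1 - z) fun j => (-α) • sagaDirection G s j
  simp only [mean_smul, mean_sagaDirection, norm_smul, mul_pow, mean_mul, Real.norm_eq_abs, sq_abs,
    neg_sq, real_inner_smul_right] at h
  have hstep (j : Fin m) : (sagaStep G α s j).1 - z = s.1 - z + (-α) • sagaDirection G s j := by
    rw [sagaStep_fst, neg_smul]
    abel
  simp only [hstep, h, real_inner_comm (s.1 - z)]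
  ring

theorem mean_norm_sagaStep_sub_sq_le (hg : ∀ i, HasQuadraticBounds (g i) (G i) μ L) (hμ : 0 ≤ μ)
    (hL : μ < L) (hα : 0 ≤ α) (hβ : 0 < β) (hz : mean (fun i => G i z) = 0)
    (s : E n × (Fin m → E n)) :
    mean (fun j => ‖(sagaStep G α s j).1 - z‖ ^ 2) ≤
      (1 - α * μ) * ‖s.1 - z‖ ^ 2 +
        ((1 + β) * α ^ 2 - α / L) * mean (fun j => ‖G j s.1 - G j z‖ ^ 2) -
        2 * α * ((L - μ) / L + α * β * μ) *
          (mean (fun i => g i s.1) - mean fun i => g i z) +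
        2 * (1 + 1 / β) * α ^ 2 * L * tableGap g G z s.2 := by
  have hL0 : 0 < L := hμ.trans_lt hL
  have hdir := mul_le_mul_of_nonneg_left (mean_norm_sagaDirection_sq_le hg hμ hL0 hβ hz s)
    (sq_nonneg α)
  have hint := mul_le_mul_of_nonneg_left (mean_interpolation hg hL hL0 hz s.1)
    (by positivity : 0 ≤ 2 * α)
  rw [mean_norm_sagaStep_sub_sq]
  have hdiv : 2 * α * (1 / (2 * L) * mean fun j => ‖G j s.1 - G j z‖ ^ 2) =
      α / L * mean fun j => ‖G j s.1 - G j z‖ ^ 2 := by field_simp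
  linarith

theorem mean_lyapunov_sagaStep_le (hg : ∀ i, HasQuadraticBounds (g i) (G i) μ L) (hμ : 0 ≤ μ)
    (hL : μ < L) (hα : 0 ≤ α) (hβ : 0 < β) (hc : 0 ≤ c) (hz : mean (fun i => G i z) = 0)
    (s : E n × (Fin m → E n)) :
    mean (fun j => lyapunov g G z c (sagaStep G α s j)) ≤
      c * (1 - α * μ) * ‖s.1 - z‖ ^ 2 +
        c * α * ((1 + β) * α - 1 / L) * mean (fun j => ‖G j s.1 - G j z‖ ^ 2) +
        (1 / m - 2 * c * α * ((L - μ) / L + α * β * μ)) *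
          (mean (fun i => g i s.1) - mean fun i => g i z) +
        (1 - 1 / m + 2 * c * (1 + 1 / β) * α ^ 2 * L) * tableGap g G z s.2 := by
  have htable : mean (fun j => tableGap g G z (sagaStep G α s j).2) =
      (1 - 1 / m) * tableGap g G z s.2 +
        1 / m * (mean (fun i => g i s.1) - mean fun i => g i z) := by
    rw [← mean_bregman_eq hz]
    have h := mean_mean_update (fun i => bregman (g i) (G i) z) s.2 s.1
    rwa [Fintype.card_fin] at h
  have hdist := mul_le_mul_of_nonneg_left (mean_norm_sagaStep_sub_sq_le hg hμ hL hα hβ hz s) hc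
  simp only [lyapunov, mean_add, mean_mul, htable]
  refine (add_le_add_right hdist _).trans_eq ?_
  ring

theorem one_sub_stepSize_mul_pos {s : ℝ} (hμ : 0 ≤ μ) (hμs : μ ≤ s) (hL : 0 < L)
    (hα : α = 1 / (2 * (s + L))) : 0 < 1 - α * μ := by
  have hs : 0 ≤ s := hμ.trans hμs
  rw [hα, sub_pos, one_div_mul_eq_div, div_lt_one (by positivity)]
  linarith

theorem le_mul_one_sub_stepSize_mul {s : ℝ} (hμ : 0 ≤ μ) (hμs : μ ≤ s) (hL : 0 < L)
    (hα : α = 1 / (2 * (s + L))) :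
    L ≤ (2 * s + L) * (1 - α * s) * (1 - α * μ) := by
  have hs : 0 ≤ s := hμ.trans hμs
  have hα0 : 0 < α := by rw [hα]; positivity
  have hαs : 0 < 1 - α * s := one_sub_stepSize_mul_pos hs le_rfl hL hα
  calc L ≤ (2 * s + L) * (1 - α * s) * (1 - α * s) := by
        have hfrac : 1 - α * s = (s + 2 * L) / (2 * (s + L)) := by
          rw [hα]
          field_simp
          ring
        rw [hfrac, mul_assoc, ← sq, div_pow, mul_div_assoc', le_div_iff₀ (by positivity)]
        have : 0 ≤ 2 * s ^ 3 + 5 * s ^ 2 * L + 4 * s * L ^ 2 := by positivity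
        linarith
    _ ≤ _ := by gcongr

theorem tableGap_coeff_le_one_sub_stepSize_mul (hμ : 0 ≤ μ) (hL : 0 < L)
    (hα : α = 1 / (2 * (μ * m + L))) :
    1 - 1 / (m : ℝ) + 2 * (1 / (2 * α * (1 - α * μ) * m)) * (1 + 1 / ((2 * μ * m + L) / L)) *
      α ^ 2 * L ≤ 1 - α * μ := by
  have hm : (1 : ℝ) ≤ m := by exact_mod_cast NeZero.one_le
  have hα0 : 0 < α := by rw [hα]; positivity
  have hμm : μ ≤ μ * m := le_mul_of_one_le_right hμ hm
  have hfactor := le_mul_one_sub_stepSize_mul hμ hμm hL hα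
  have hq : 0 < 1 - α * μ := one_sub_stepSize_mul_pos hμ hμm hL hα
  set q := 1 - α * μ
  have hβα : (1 + 1 / ((2 * μ * m + L) / L)) * α = 1 / (2 * μ * m + L) := by
    rw [hα]
    field_simp
    ring
  have hcoeff : 2 * (1 / (2 * α * q * m)) * (1 + 1 / ((2 * μ * m + L) / L)) * α ^ 2 * L =
      L / ((2 * μ * m + L) * q) / m := by
    calc _ = 2 * (1 / (2 * α * q * m)) * ((1 + 1 / ((2 * μ * m + L) / L)) * α) * α * L := by ring
      _ = _ := by
        rw [hβα]
        field_simp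
  have hle : L / ((2 * μ * m + L) * q) / m ≤ (1 - α * (μ * m)) / m := by
    gcongr
    rw [div_le_iff₀ (by positivity)]
    linarith
  have hsplit : (1 - α * (μ * m)) / m = 1 / m - α * μ := by field_simp
  linarith

theorem mean_lyapunov_sagaStep_le_of_stronglyConvex
    (hg : ∀ i, HasQuadraticBounds (g i) (G i) μ L) (hμ : 0 < μ)
    (hL : μ < L) (hα : α = 1 / (2 * (μ * m + L))) (hz : mean (fun i => G i z) = 0)
    (s : E n × (Fin m → E n)) :
    mean (fun j => lyapunov g G z (1 / (2 * α * (1 - α * μ) * m)) (sagaStep G α s j)) ≤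
      (1 - α * μ) * lyapunov g G z (1 / (2 * α * (1 - α * μ) * m)) s := by
  have hL0 : 0 < L := hμ.trans hL
  have hm : (1 : ℝ) ≤ m := by exact_mod_cast NeZero.one_le
  have hα0 : 0 < α := by rw [hα]; positivity
  have hμm : μ ≤ μ * m := le_mul_of_one_le_right hμ.le hm
  have hq : 0 < 1 - α * μ := one_sub_stepSize_mul_pos hμ.le hμm hL0 hα
  have htable := tableGap_coeff_le_one_sub_stepSize_mul hμ.le hL0 hα
  set q := 1 - α * μ with hq_def
  set β := (2 * μ * m + L) / L with hβ
  set c := 1 / (2 * α * q * m) with hc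
  have h := mean_lyapunov_sagaStep_le hg hμ.le hL hα0.le (by positivity : 0 < β)
    (by positivity : 0 ≤ c) hz s
  have hgrad : (1 + β) * α - 1 / L = 0 := by
    rw [hα, hβ]
    field_simp
    ring
  have hgap : 1 / (m : ℝ) - 2 * c * α * ((L - μ) / L + α * β * μ) = 0 := by
    have : (L - μ) / L + α * β * μ = q := by
      rw [hq_def, hα, hβ]
      field_simp
      ring
    rw [this, hc]
    field_simp
    simp
  have hmono := mul_le_mul_of_nonneg_right htable (tableGap_nonneg hg hμ.le z s.2)
  rw [hgrad, hgap] at h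
  rw [lyapunov]
  linarith

theorem mean_lyapunov_sagaStep_le_of_convex (hg : ∀ i, HasQuadraticBounds (g i) (G i) 0 L)
    (hL : 0 < L) (hα : α = 1 / (3 * L)) (hz : mean (fun i => G i z) = 0)
    (s : E n × (Fin m → E n)) :
    mean (fun j => lyapunov g G z (1 / (α * m)) (sagaStep G α s j)) +
        1 / m * (mean (fun i => g i s.1) - mean fun i => g i z) ≤
      lyapunov g G z (1 / (α * m)) s := by
  have hm : (m : ℝ) ≠ 0 := NeZero.ne _
  have hα0 : 0 < α := by rw [hα]; positivity
  have h := mean_lyapunov_sagaStep_le hg le_rfl hL hα0.le two_pos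
    (by positivity : 0 ≤ 1 / (α * m)) hz s
  have hgrad : (1 + 2) * α - 1 / L = 0 := by
    rw [hα]
    field_simp
    ring
  have hgap : 1 / (m : ℝ) - 2 * (1 / (α * m)) * α * ((L - 0) / L + α * 2 * 0) = -(1 / m) := by
    field_simp
    ring
  have htable : 1 - 1 / (m : ℝ) + 2 * (1 / (α * m)) * (1 + 1 / 2) * α ^ 2 * L = 1 := by
    rw [hα]
    field_simp
    ring
  rw [hgrad, hgap, htable] at h
  rw [lyapunov]
  linarith

end Step

section Sampling

variable {n m : ℕ} {Ω : Type*} [MeasurableSpace Ω] {P : Measure Ω}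

theorem integrable_mean {ι : Type*} [Fintype ι] {u : ι → Ω → ℝ} (hu : ∀ i, Integrable (u i) P) :
    Integrable (fun ω => mean fun i => u i ω) P :=
  (integrable_finsetSum _ fun i _ => hu i).smul (1 / (Fintype.card ι : ℝ))

theorem integral_mean {ι : Type*} [Fintype ι] {u : ι → Ω → ℝ} (hu : ∀ i, Integrable (u i) P) :
    ∫ ω, mean (fun i => u i ω) ∂P = mean fun i => ∫ ω, u i ω ∂P := by
  simp only [mean, smul_eq_mul]
  rw [integral_const_mul, integral_finsetSum _ fun i _ => hu i]

theorem integrable_comp_of_dependsOn [IsFiniteMeasure P] {κ ι : Type*} [Finite ι]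
    [MeasurableSpace ι] [MeasurableSingletonClass ι] {J : κ → Ω → ι} (hJ : ∀ k, Measurable (J k))
    {s : Finset κ} {Ψ : (κ → ι) → ℝ} (hΨ : DependsOn Ψ s) :
    Integrable (fun ω => Ψ fun k => J k ω) P := by
  obtain ⟨Φ, rfl⟩ := dependsOn_iff_exists_comp.1 hΨ
  have hX : Measurable fun ω (k : (s : Set κ)) => J k ω := measurable_pi_lambda _ fun k => hJ k
  have : IsFiniteMeasure (P.map fun ω (k : (s : Set κ)) => J k ω) :=
    Measure.isFiniteMeasure_map P _
  exact (Integrable.of_finite (f := Φ)).comp_measurable hX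

theorem integral_comp_eq_integral_mean_of_indepFun [IsFiniteMeasure P] {S ι : Type*} [Finite S]
    [MeasurableSpace S] [MeasurableSingletonClass S] [Fintype ι] [MeasurableSpace ι]
    [MeasurableSingletonClass ι] {X : Ω → S} {Y : Ω → ι} (hX : Measurable X) (hY : Measurable Y)
    (hXY : IndepFun X Y P) (hunif : ∀ i, P.real (Y ⁻¹' {i}) = 1 / (Fintype.card ι : ℝ))
    (Φ : S → ι → ℝ) :
    ∫ ω, Φ (X ω) (Y ω) ∂P = ∫ ω, mean (Φ (X ω)) ∂P := by
  have hfin : IsFiniteMeasure (P.map X) := Measure.isFiniteMeasure_map P X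
  have hfin' : IsFiniteMeasure (P.map Y) := Measure.isFiniteMeasure_map P Y
  have hmean (x : S) : ∫ i, Φ x i ∂P.map Y = mean (Φ x) := by
    rw [integral_fintype .of_finite, mean, Finset.smul_sum]
    simp only [map_measureReal_apply hY (measurableSet_singleton _), hunif]
  calc ∫ ω, Φ (X ω) (Y ω) ∂P
      = ∫ p, Φ p.1 p.2 ∂(P.map X).prod (P.map Y) := by
        rw [← (indepFun_iff_map_prod_eq_prod_map_map hX.aemeasurable hY.aemeasurable).1 hXY,
          integral_map (hX.prodMk hY).aemeasurable
            (measurable_of_finite _).aestronglyMeasurable]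
    _ = ∫ x, mean (Φ x) ∂P.map X := by
        rw [integral_prod _ .of_finite]
        simp only [hmean]
    _ = ∫ ω, mean (Φ (X ω)) ∂P :=
        integral_map hX.aemeasurable (measurable_of_finite _).aestronglyMeasurable

theorem dependsOn_sagaState (G : Fin m → E n → E n) (α : ℝ) (x0 : E n) :
    ∀ t, DependsOn (fun j => sagaState G α x0 j t) (Finset.range t : Set ℕ)
  | 0, _, _, _ => rfl
  | t + 1, j, j', h => by
    have ih : sagaState G α x0 j t = sagaState G α x0 j' t :=
      dependsOn_sagaState G α x0 t fun k hk => h k (Finset.range_mono t.le_succ hk)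
    simp only [sagaState, ih, h t (Finset.self_mem_range_succ t)]

variable [IsProbabilityMeasure P] {J : ℕ → Ω → Fin m} (hJ : IsUniformSampling P J)
include hJ

theorem integrable_sagaState (G : Fin m → E n → E n) (α : ℝ) (x0 : E n) (t : ℕ)
    (Ψ : E n × (Fin m → E n) → ℝ) :
    Integrable (fun ω => Ψ (sagaState G α x0 (fun k => J k ω) t)) P :=
  integrable_comp_of_dependsOn hJ.measurable fun _ _ h =>
    congrArg Ψ (dependsOn_sagaState G α x0 t h)

theorem integral_sagaState_succ (G : Fin m → E n → E n) (α : ℝ) (x0 : E n) (t : ℕ)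
    (Ψ : E n × (Fin m → E n) → ℝ) :
    ∫ ω, Ψ (sagaState G α x0 (fun k => J k ω) (t + 1)) ∂P =
      ∫ ω, mean (fun i => Ψ (sagaStep G α (sagaState G α x0 (fun k => J k ω) t) i)) ∂P := by
  obtain ⟨Φ, hΦ⟩ := dependsOn_iff_exists_comp.1 (dependsOn_sagaState G α x0 t)
  have hpast : Measurable fun ω (k : (Finset.range t : Set ℕ)) => J k ω :=
    measurable_pi_lambda _ fun k => hJ.measurable k
  have hindep : IndepFun (fun ω (k : (Finset.range t : Set ℕ)) => J k ω) (J t) P :=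
    (hJ.indep.indepFun_finset (Finset.range t) {t} (by simp) hJ.measurable).comp
      measurable_id (measurable_pi_apply (⟨t, by simp⟩ : ({t} : Finset ℕ)))
  have h := integral_comp_eq_integral_mean_of_indepFun hpast (hJ.measurable t) hindep
    (by simpa using hJ.uniform t) fun p i => Ψ (sagaStep G α (Φ p) i)
  have hstate (ω : Ω) : sagaState G α x0 (fun k => J k ω) t =
      Φ fun k : (Finset.range t : Set ℕ) => J k ω := congrFun hΦ fun k => J k ω
  simpa only [sagaState, hstate] using h

theorem integral_sagaState_le_pow_mul {G : Fin m → E n → E n} {α q : ℝ}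
    {Ψ : E n × (Fin m → E n) → ℝ} (hq : 0 ≤ q)
    (hΨ : ∀ s, mean (fun j => Ψ (sagaStep G α s j)) ≤ q * Ψ s) (x0 : E n) (t : ℕ) :
    ∫ ω, Ψ (sagaState G α x0 (fun k => J k ω) t) ∂P ≤ q ^ t * Ψ (x0, fun _ => x0) := by
  induction t with
  | zero => simp [sagaState]
  | succ t ih =>
    calc ∫ ω, Ψ (sagaState G α x0 (fun k => J k ω) (t + 1)) ∂P
        ≤ ∫ ω, q * Ψ (sagaState G α x0 (fun k => J k ω) t) ∂P := by
          rw [integral_sagaState_succ hJ]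
          exact integral_mono
            (integrable_sagaState hJ G α x0 t fun s => mean fun j => Ψ (sagaStep G α s j))
            ((integrable_sagaState hJ G α x0 t Ψ).const_mul q) fun ω => hΨ _
      _ ≤ q ^ (t + 1) * Ψ (x0, fun _ => x0) := by
          rw [integral_const_mul, pow_succ', mul_assoc]
          exact mul_le_mul_of_nonneg_left ih hq

theorem sum_integral_sagaState_le {G : Fin m → E n → E n} {α : ℝ}
    {Ψ Θ : E n × (Fin m → E n) → ℝ} (hΨ0 : ∀ s, 0 ≤ Ψ s)
    (hΨ : ∀ s, mean (fun j => Ψ (sagaStep G α s j)) + Θ s ≤ Ψ s) (x0 : E n) (t : ℕ) :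
    ∑ k ∈ Finset.range t, ∫ ω, Θ (sagaState G α x0 (fun k => J k ω) k) ∂P ≤
      Ψ (x0, fun _ => x0) := by
  have hstep (t : ℕ) : ∫ ω, Ψ (sagaState G α x0 (fun k => J k ω) (t + 1)) ∂P +
      ∫ ω, Θ (sagaState G α x0 (fun k => J k ω) t) ∂P ≤
      ∫ ω, Ψ (sagaState G α x0 (fun k => J k ω) t) ∂P := by
    have hmean := integrable_sagaState hJ G α x0 t fun s => mean fun j => Ψ (sagaStep G α s j)
    have hΘ := integrable_sagaState hJ G α x0 t Θ
    rw [integral_sagaState_succ hJ, ← integral_add hmean hΘ]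
    exact integral_mono (hmean.add hΘ) (integrable_sagaState hJ G α x0 t Ψ) fun ω => hΨ _
  have htel : ∑ k ∈ Finset.range t, ∫ ω, Θ (sagaState G α x0 (fun k => J k ω) k) ∂P +
      ∫ ω, Ψ (sagaState G α x0 (fun k => J k ω) t) ∂P ≤ Ψ (x0, fun _ => x0) := by
    induction t with
    | zero => simp [sagaState]
    | succ t ih =>
      rw [Finset.sum_range_succ]
      linarith [hstep t]
  have : 0 ≤ ∫ ω, Ψ (sagaState G α x0 (fun k => J k ω) t) ∂P := integral_nonneg fun ω => hΨ0 _
  linarith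

variable [NeZero m] {g : Fin m → E n → ℝ} {G : Fin m → E n → E n} {z : E n} {μ L α : ℝ}

theorem exists_integral_norm_sagaState_sub_sq_le_mul_pow
    (hg : ∀ i, HasQuadraticBounds (g i) (G i) μ L) (hμ : 0 < μ) (hL : μ < L)
    (hα : α = 1 / (2 * (μ * m + L))) (hz : mean (fun i => G i z) = 0) (x0 : E n) :
    ∃ C : ℝ, ∀ t : ℕ,
      ∫ ω, ‖(sagaState G α x0 (fun k => J k ω) t).1 - z‖ ^ 2 ∂P ≤ C * (1 - α * μ) ^ t := by
  have hm : (1 : ℝ) ≤ m := by exact_mod_cast NeZero.one_le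
  have hL0 : 0 < L := hμ.trans hL
  have hα0 : 0 < α := by rw [hα]; positivity
  have hq : 0 < 1 - α * μ :=
    one_sub_stepSize_mul_pos hμ.le (le_mul_of_one_le_right hμ.le hm) hL0 hα
  set c := 1 / (2 * α * (1 - α * μ) * m)
  have hc0 : 0 < c := by positivity
  refine ⟨lyapunov g G z c (x0, fun _ => x0) / c, fun t => ?_⟩
  have hdecay := integral_sagaState_le_pow_mul hJ hq.le
    (mean_lyapunov_sagaStep_le_of_stronglyConvex hg hμ hL hα hz) x0 t
  rw [div_mul_eq_mul_div, le_div_iff₀' hc0, ← integral_const_mul, mul_comm (lyapunov ..)]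
  refine le_trans (integral_mono ?_ ?_ fun ω => ?_) hdecay
  · exact integrable_sagaState hJ G α x0 t fun s => c * ‖s.1 - z‖ ^ 2
  · exact integrable_sagaState hJ G α x0 t _
  · exact mul_norm_sq_le_lyapunov hg hμ.le z c _

theorem exists_sum_integral_gap_sagaState_le (hg : ∀ i, HasQuadraticBounds (g i) (G i) 0 L)
    (hL : 0 < L) (hα : α = 1 / (3 * L)) (hz : mean (fun i => G i z) = 0) (x0 : E n) :
    ∃ C : ℝ, ∀ t : ℕ, ∑ k ∈ Finset.range t,
      ∫ ω, (mean (fun i => g i (sagaState G α x0 (fun k => J k ω) k).1) -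
        mean fun i => g i z) ∂P ≤ C := by
  have hm : (0 : ℝ) < m := by exact_mod_cast NeZero.pos m
  have hα0 : 0 < α := by rw [hα]; positivity
  refine ⟨m * lyapunov g G z (1 / (α * m)) (x0, fun _ => x0), fun t => ?_⟩
  have h := sum_integral_sagaState_le hJ
    (fun s => le_trans (by positivity) (mul_norm_sq_le_lyapunov hg le_rfl z (1 / (α * m)) s))
    (mean_lyapunov_sagaStep_le_of_convex hg hL hα hz) x0 t
  simp only [integral_const_mul, ← Finset.mul_sum] at h
  rwa [one_div_mul_eq_div, div_le_iff₀' hm] at h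

end Sampling

section Huber

variable {δ u : ℝ}

/-- The one-sided Huber function of a real variable, with smoothing parameter `δ`: the penalty
`h_δ(x; a, b)` is its value at `⟨a, x⟩ - b`, divided by `‖a‖`. -/
noncomputable def huber (δ u : ℝ) : ℝ :=
  if δ < u then u else if -δ ≤ u then (u + δ) ^ 2 / (4 * δ) else 0

/-- The derivative of `huber δ`. -/
noncomputable def huberSlope (δ u : ℝ) : ℝ :=
  if δ < u then 1 else if -δ ≤ u then (u + δ) / (2 * δ) else 0

theorem add_huberSlope_mul_le (hδ : 0 < δ) (u v : ℝ) :
    huber δ u + huberSlope δ u * (v - u) ≤ huber δ v := by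
  unfold huber huberSlope
  split_ifs <;> field_simp <;> nlinarith [sq_nonneg (u - v)]

theorem huber_le_add (hδ : 0 < δ) (u v : ℝ) :
    huber δ v ≤ huber δ u + huberSlope δ u * (v - u) + (v - u) ^ 2 / (4 * δ) := by
  unfold huber huberSlope
  split_ifs <;> field_simp <;> nlinarith

theorem huber_nonneg (hδ : 0 < δ) (u : ℝ) : 0 ≤ huber δ u := by
  unfold huber
  split_ifs
  · linarith
  · positivity
  · rfl

theorem le_huber (hδ : 0 < δ) (u : ℝ) : u ≤ huber δ u := by
  unfold huber
  split_ifs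
  · rfl
  · rw [le_div_iff₀ (by positivity)]
    linarith [sq_nonneg (u - δ)]
  · linarith

theorem huber_le_of_nonpos (hδ : 0 < δ) (hu : u ≤ 0) : huber δ u ≤ δ / 4 := by
  unfold huber
  split_ifs
  · linarith
  · rw [div_le_div_iff₀ (by positivity) (by positivity)]
    nlinarith
  · positivity

theorem lt_huber_of_pos (hδ : 0 < δ) (hu : 0 < u) : δ / 4 < huber δ u := by
  unfold huber
  split_ifs
  · linarith
  · rw [div_lt_div_iff₀ (by positivity) (by positivity)]
    nlinarith
  · linarith

theorem huber_eq_zero (hδ : 0 < δ) (hu : u ≤ -δ) : huber δ u = 0 := by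
  unfold huber
  split_ifs with hlt hle
  · linarith
  · simp [le_antisymm hu hle]
  · rfl

end Huber

section Penalty

variable {n m : ℕ} {δ : ℝ} {a : E n}

theorem penalty_eq_huber (δ : ℝ) (a : E n) (b : ℝ) (x : E n) :
    penalty δ a b x = huber δ (inner ℝ a x - b) / ‖a‖ := by
  unfold penalty huber
  split_ifs
  · rfl
  · rw [div_div]
  · rw [zero_div]

theorem penalty_nonneg (hδ : 0 < δ) (a : E n) (b : ℝ) (x : E n) : 0 ≤ penalty δ a b x := by
  rw [penalty_eq_huber]
  exact div_nonneg (huber_nonneg hδ _) (norm_nonneg _)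

/-- The gradient of the penalty `h_δ(·; a, b)`. -/
noncomputable def penaltySlope (δ : ℝ) (a : E n) (b : ℝ) (x : E n) : E n :=
  (huberSlope δ (inner ℝ a x - b) / ‖a‖) • a

theorem bregman_penalty (δ : ℝ) (a : E n) (b : ℝ) (x y : E n) :
    bregman (penalty δ a b) (penaltySlope δ a b) x y =
      (huber δ (inner ℝ a y - b) - huber δ (inner ℝ a x - b) -
        huberSlope δ (inner ℝ a x - b) * (inner ℝ a y - b - (inner ℝ a x - b))) / ‖a‖ := by
  rw [bregman, penalty_eq_huber, penalty_eq_huber, penaltySlope, real_inner_smul_left,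
    inner_sub_right]
  ring

theorem hasQuadraticBounds_penalty (hδ : 0 < δ) (ha : a ≠ 0) (b : ℝ) :
    HasQuadraticBounds (penalty δ a b) (penaltySlope δ a b) 0 (‖a‖ / (2 * δ)) where
  lower x y := by
    rw [bregman_penalty, zero_div, zero_mul]
    refine div_nonneg ?_ (norm_nonneg a)
    linarith [add_huberSlope_mul_le hδ (inner ℝ a x - b) (inner ℝ a y - b)]
  upper x y := by
    have ha' : 0 < ‖a‖ := norm_pos_iff.2 ha
    have hinner : (inner ℝ a y - b - (inner ℝ a x - b)) ^ 2 ≤ (‖a‖ * ‖y - x‖) ^ 2 := by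
      rw [sub_sub_sub_cancel_right, ← inner_sub_right]
      exact sq_le_sq.2 ((abs_real_inner_le_norm a (y - x)).trans (le_abs_self _))
    rw [bregman_penalty, div_le_iff₀ ha']
    calc _ ≤ (inner ℝ a y - b - (inner ℝ a x - b)) ^ 2 / (4 * δ) := by
          linarith [huber_le_add hδ (inner ℝ a x - b) (inner ℝ a y - b)]
      _ ≤ (‖a‖ * ‖y - x‖) ^ 2 / (4 * δ) := by gcongr
      _ = ‖a‖ / (2 * δ) / 2 * ‖y - x‖ ^ 2 * ‖a‖ := by ring

theorem gradient_penalty (hδ : 0 < δ) (ha : a ≠ 0) (b : ℝ) (x : E n) :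
    gradient (penalty δ a b) x = penaltySlope δ a b x :=
  ((hasQuadraticBounds_penalty hδ ha b).hasGradientAt le_rfl x).gradient

theorem alphaMin_le (a : Fin m → E n) (i : Fin m) : alphaMin a ≤ ‖a i‖ :=
  ciInf_le (Set.finite_range _).bddBelow i

theorem le_alphaMax (a : Fin m → E n) (i : Fin m) : ‖a i‖ ≤ alphaMax a :=
  le_ciSup (f := fun j => ‖a j‖) (Set.finite_range _).bddAbove i

theorem alphaMin_pos [NeZero m] {a : Fin m → E n} (ha : ∀ i, a i ≠ 0) : 0 < alphaMin a := by
  obtain ⟨i, hi⟩ := exists_eq_ciInf_of_finite (f := fun j => ‖a j‖)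
  rw [alphaMin, ← hi]
  exact norm_pos_iff.2 (ha i)

theorem alphaMax_pos [NeZero m] {a : Fin m → E n} (ha : ∀ i, a i ≠ 0) : 0 < alphaMax a :=
  (norm_pos_iff.2 (ha 0)).trans_le (le_alphaMax a 0)

theorem penalty_le_of_mem_feasible [NeZero m] {a : Fin m → E n} (ha : ∀ i, a i ≠ 0) (hδ : 0 < δ)
    {b : Fin m → ℝ} {x : E n} (hx : x ∈ feasible a b) (i : Fin m) :
    penalty δ (a i) (b i) x ≤ δ / (4 * alphaMin a) := by
  rw [penalty_eq_huber, ← div_div]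
  exact div_le_div₀ (by positivity) (huber_le_of_nonpos hδ (Set.mem_iInter.1 hx i))
    (alphaMin_pos ha) (alphaMin_le a i)

end Penalty

section PenalizedObjective

variable {n m : ℕ} {f : E n → ℝ} {a : Fin m → E n} {b : Fin m → ℝ} {μ L γ δ : ℝ}

theorem HasLipschitzGradient.hasQuadraticBounds (hf : HasLipschitzGradient f L)
    (hμ : StrongConvexOn Set.univ μ f) : HasQuadraticBounds f (gradient f) μ L where
  lower x y := le_bregman_gradient hμ (hf.1 x) y
  upper := bregman_gradient_le hf.1 hf.2

theorem hasQuadraticBounds_add_penalty (hf : HasQuadraticBounds f (gradient f) μ L)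
    (ha : ∀ i, a i ≠ 0) (b : Fin m → ℝ) (hγ : 0 ≤ γ) (hδ : 0 < δ) (i : Fin m) :
    HasQuadraticBounds (fun x => f x + γ * penalty δ (a i) (b i) x) (compGrad f a b γ δ i) μ
      (L + γ * alphaMax a / (2 * δ)) := by
  have h := hf.add ((hasQuadraticBounds_penalty hδ (ha i) (b i)).const_mul hγ)
  simp only [← gradient_penalty hδ (ha i)] at h
  refine h.mono (by simp) ?_
  rw [mul_div_assoc]
  have := le_alphaMax a i
  gcongr

theorem mean_add_penalty [NeZero m] (f : E n → ℝ) (a : Fin m → E n) (b : Fin m → ℝ) (γ δ : ℝ)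
    (x : E n) : (mean fun i => f x + γ * penalty δ (a i) (b i) x) = penObj f a b γ δ x := by
  rw [mean_add, mean_const, mean_fin, ← Finset.mul_sum, penObj, smul_eq_mul]
  ring

theorem hasQuadraticBounds_penObj [NeZero m] (hf : HasQuadraticBounds f (gradient f) μ L)
    (ha : ∀ i, a i ≠ 0) (b : Fin m → ℝ) (hγ : 0 ≤ γ) (hδ : 0 < δ) :
    HasQuadraticBounds (penObj f a b γ δ) (fun x => mean fun i => compGrad f a b γ δ i x) μ
      (L + γ * alphaMax a / (2 * δ)) := by
  simpa only [mean_add_penalty] using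
    HasQuadraticBounds.mean (hasQuadraticBounds_add_penalty hf ha b hγ hδ)

theorem le_penObj (f : E n → ℝ) (a : Fin m → E n) (b : Fin m → ℝ) (hγ : 0 ≤ γ) (hδ : 0 < δ)
    (x : E n) : f x ≤ penObj f a b γ δ x :=
  le_add_of_nonneg_right (mul_nonneg (by positivity)
    (Finset.sum_nonneg fun i _ => penalty_nonneg hδ _ _ _))

theorem penObj_le_of_mem_feasible [NeZero m] (f : E n → ℝ) (ha : ∀ i, a i ≠ 0) (hγ : 0 ≤ γ)
    (hδ : 0 < δ) {x : E n} (hx : x ∈ feasible a b) :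
    penObj f a b γ δ x ≤ f x + γ * (δ / (4 * alphaMin a)) := by
  rw [← mean_add_penalty, mean_add, mean_const, mean_mul]
  gcongr
  exact (mean_mono fun i => penalty_le_of_mem_feasible ha hδ hx i).trans_eq (mean_const _)

theorem penSolutions_nonempty [NeZero m] (hf : HasQuadraticBounds f (gradient f) μ L)
    (hμ : 0 ≤ μ) (hlev : ∀ r : ℝ, Bornology.IsBounded {x | f x ≤ r}) (ha : ∀ i, a i ≠ 0)
    (b : Fin m → ℝ) (hγ : 0 ≤ γ) (hδ : 0 < δ) : (penSolutions f a b γ δ).Nonempty :=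
  ((hasQuadraticBounds_penObj hf ha b hγ hδ).continuous hμ).exists_forall_le_of_isBounded 0
    ((hlev _).subset fun x hx => (le_penObj f a b hγ hδ x).trans hx)

theorem mean_compGrad_eq_zero [NeZero m] (hf : HasQuadraticBounds f (gradient f) μ L)
    (hμ : 0 ≤ μ) (ha : ∀ i, a i ≠ 0) (hγ : 0 ≤ γ) (hδ : 0 < δ) {z : E n}
    (hz : z ∈ penSolutions f a b γ δ) : (mean fun i => compGrad f a b γ δ i z) = 0 :=
  (hasQuadraticBounds_penObj hf ha b hγ hδ).slope_eq_zero hμ hz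

end PenalizedObjective

section ErrorBound

variable {n m : ℕ} {a : Fin m → E n} {b : Fin m → ℝ} {β δ ε r : ℝ} {x : E n}

theorem mem_feasible : x ∈ feasible a b ↔ ∀ i, inner ℝ (a i) x - b i ≤ 0 :=
  Set.mem_iInter

theorem isClosed_feasible (a : Fin m → E n) (b : Fin m → ℝ) : IsClosed (feasible a b) :=
  isClosed_iInter fun i => isClosed_le (by fun_prop) continuous_const

theorem proj_spec {Y : Set (E n)} (hY : IsClosed Y) (hne : Y.Nonempty) (x : E n) :
    proj Y x ∈ Y ∧ ‖x - proj Y x‖ = Metric.infDist x Y := by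
  have h : ∃ p ∈ Y, ‖x - p‖ = Metric.infDist x Y := by
    obtain ⟨p, hp, hdist⟩ := hY.exists_infDist_eq_dist hne x
    exact ⟨p, hp, by rw [hdist, dist_eq_norm]⟩
  rw [proj, dif_pos h]
  exact h.choose_spec

theorem norm_sub_proj_le {Y : Set (E n)} (hY : IsClosed Y) {p : E n} (hp : p ∈ Y) (x : E n) :
    ‖x - proj Y x‖ ≤ ‖x - p‖ := by
  rw [(proj_spec hY ⟨p, hp⟩ x).2, ← dist_eq_norm]
  exact Metric.infDist_le_dist_of_mem hp

theorem infDist_halfSpace_le {a : E n} (ha : a ≠ 0) {b : ℝ} (hr : 0 ≤ r)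
    (hx : inner ℝ a x - b ≤ r) : Metric.infDist x (halfSpace a b) ≤ r / ‖a‖ := by
  have : 0 < ‖a‖ := norm_pos_iff.2 ha
  have hmem : x - (r / ‖a‖ ^ 2) • a ∈ halfSpace a b := by
    rw [halfSpace, Set.mem_ofPred_eq, inner_sub_right, real_inner_smul_right,
      real_inner_self_eq_norm_sq, div_mul_cancel₀ _ (by positivity)]
    linarith
  refine (Metric.infDist_le_dist_of_mem hmem).trans_eq ?_
  rw [dist_eq_norm, sub_sub_cancel, norm_smul, Real.norm_eq_abs, abs_of_nonneg (by positivity)]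
  field_simp

theorem infDist_halfSpace_le_penalty (hδ : 0 < δ) {a : E n} (ha : a ≠ 0) (b : ℝ) (x : E n) :
    Metric.infDist x (halfSpace a b) ≤ penalty δ a b x := by
  rw [penalty_eq_huber]
  exact infDist_halfSpace_le ha (huber_nonneg hδ _) (le_huber hδ _)

namespace IsHoffmanConst

theorem infDist_feasible_le_sum_penalty (hβ : IsHoffmanConst a β) (ha : ∀ i, a i ≠ 0)
    (hδ : 0 < δ) (hne : (feasible a b).Nonempty) (x : E n) :
    Metric.infDist x (feasible a b) ≤ β * ∑ i, penalty δ (a i) (b i) x :=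
  (hβ.2 b hne x).trans (mul_le_mul_of_nonneg_left
    (Finset.sum_le_sum fun i _ => infDist_halfSpace_le_penalty hδ (ha i) (b i) x) hβ.1.le)

theorem infDist_feasible_le_of_forall_le [NeZero m] (hβ : IsHoffmanConst a β)
    (ha : ∀ i, a i ≠ 0) (hne : (feasible a b).Nonempty) (hr : 0 ≤ r)
    (hx : ∀ i, inner ℝ (a i) x - b i ≤ r) :
    Metric.infDist x (feasible a b) ≤ β * m * r / alphaMin a := by
  have hdist (i : Fin m) : Metric.infDist x (halfSpace (a i) (b i)) ≤ r / alphaMin a :=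
    (infDist_halfSpace_le (ha i) hr (hx i)).trans
      (div_le_div_of_nonneg_left hr (alphaMin_pos ha) (alphaMin_le a i))
  calc Metric.infDist x (feasible a b)
      ≤ β * ∑ i, Metric.infDist x (halfSpace (a i) (b i)) := hβ.2 b hne x
    _ ≤ β * ∑ _i : Fin m, r / alphaMin a :=
        mul_le_mul_of_nonneg_left (Finset.sum_le_sum fun i _ => hdist i) hβ.1.le
    _ = β * m * r / alphaMin a := by
        rw [Finset.sum_const, Finset.card_univ, Fintype.card_fin, nsmul_eq_mul]
        ring

theorem exists_unpenalized_near [NeZero m] (hβ : IsHoffmanConst a β) (ha : ∀ i, a i ≠ 0)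
    (hint : ∃ y : E n, ∀ i, inner ℝ (a i) y - b i ≤ -δ) (hδ : 0 < δ) (hx : x ∈ feasible a b) :
    ∃ z ∈ feasible a b, (∀ i, penalty δ (a i) (b i) z = 0) ∧
      ‖x - z‖ ≤ β * m * δ / alphaMin a := by
  -- `z` is the point nearest to `x` of the polyhedron with the right-hand sides lowered by `δ`.
  have hshift (z : E n) : z ∈ feasible a (fun i => b i - δ) ↔ ∀ i, inner ℝ (a i) z - b i ≤ -δ := by
    rw [mem_feasible]
    exact forall_congr' fun i => by constructor <;> intro h <;> linarith
  have hne : (feasible a fun i => b i - δ).Nonempty := hint.imp fun y => (hshift y).2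
  obtain ⟨z, hz, hdist⟩ := (isClosed_feasible a _).exists_infDist_eq_dist hne x
  rw [hshift] at hz
  refine ⟨z, mem_feasible.2 fun i => (hz i).trans (neg_nonpos.2 hδ.le), fun i => ?_, ?_⟩
  · rw [penalty_eq_huber, huber_eq_zero hδ (hz i), zero_div]
  · rw [← dist_eq_norm, ← hdist]
    exact hβ.infDist_feasible_le_of_forall_le ha hne hδ.le fun i => by
      linarith [mem_feasible.1 hx i]

end IsHoffmanConst

theorem lt_sum_penalty_of_notMem_feasible (ha : ∀ i, a i ≠ 0) (hδ : 0 < δ)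
    (hx : x ∉ feasible a b) : δ / (4 * alphaMax a) < ∑ i, penalty δ (a i) (b i) x := by
  obtain ⟨i, hi⟩ : ∃ i, 0 < inner ℝ (a i) x - b i := by
    simpa only [mem_feasible, not_forall, not_le] using hx
  calc δ / (4 * alphaMax a) = δ / 4 / alphaMax a := by rw [div_div]
    _ < penalty δ (a i) (b i) x := by
        rw [penalty_eq_huber]
        exact div_lt_div₀ (lt_huber_of_pos hδ hi) (le_alphaMax a i) (huber_nonneg hδ _)
          (norm_pos_iff.2 (ha i))
    _ ≤ ∑ i, penalty δ (a i) (b i) x := Finset.single_le_sum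
        (f := fun i => penalty δ (a i) (b i) x) (fun i _ => penalty_nonneg hδ _ _ _)
        (Finset.mem_univ i)

end ErrorBound

section SubgradBound

variable {n : ℕ} {f : E n → ℝ} {μ L R : ℝ} {x s : E n}

theorem eq_gradient_of_mem_subdiff (hf : DifferentiableAt ℝ f x) (hs : s ∈ subdiff f x) :
    s = gradient f x := by
  have hmin : IsLocalMin (fun y => f y - inner ℝ s y) x :=
    .of_forall fun y => by linarith [hs y, inner_sub_right (𝕜 := ℝ) s y x]
  have hder := hf.hasGradientAt.hasFDerivAt.sub (innerSL ℝ s).hasFDerivAt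
  have h := sub_eq_zero.1 (hmin.hasFDerivAt_eq_zero hder)
  exact ((InnerProductSpace.toDual ℝ (E n)).injective (h.trans (by ext; simp))).symm

theorem gradient_mem_subdiff (hf : HasQuadraticBounds f (gradient f) μ L) (hμ : 0 ≤ μ) (x : E n) :
    gradient f x ∈ subdiff f x := fun y => by
  have h := hf.bregman_nonneg hμ x y
  rw [bregman] at h
  linarith

theorem norm_gradient_le_subgradBound (hf : HasQuadraticBounds f (gradient f) μ L) (hμ : 0 ≤ μ)
    (hL : 0 < L) (hx : ‖x‖ ≤ R) : ‖gradient f x‖ ≤ subgradBound f R := by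
  refine le_csSup ⟨‖gradient f 0‖ + L * R, ?_⟩ ⟨x, _, hx, gradient_mem_subdiff hf hμ x, rfl⟩
  rintro r ⟨y, s, hy, hs, rfl⟩
  rw [eq_gradient_of_mem_subdiff (hf.hasGradientAt hμ y).differentiableAt hs]
  calc ‖gradient f y‖ ≤ ‖gradient f 0‖ + ‖gradient f y - gradient f 0‖ :=
        norm_le_insert' _ _
    _ ≤ ‖gradient f 0‖ + L * ‖y - 0‖ := by
        gcongr
        exact hf.norm_sub_le hμ hL y 0
    _ ≤ ‖gradient f 0‖ + L * R := by
        rw [sub_zero]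
        gcongr

theorem subgradBound_nonneg (f : E n → ℝ) (R : ℝ) : 0 ≤ subgradBound f R :=
  Real.sSup_nonneg (by rintro r ⟨x, s, -, -, rfl⟩; exact norm_nonneg s)

end SubgradBound

section Exactness

theorem lt_of_dist_le_sqrt {A B M β γ δ Λ d S : ℝ} (hB : 0 < B) (hM : 0 < M) (hγ : 0 < γ)
    (hδ : 0 < δ) (hΛ : 0 ≤ Λ) (hS : δ / (4 * B) < S)
    (hcmp : γ / M * S ≤ Λ * (d + β * M * δ / A)) (hd : d ≤ √δ) :
    γ < 4 * M * Λ * B * (1 / √δ + β * M / A) := by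
  have hδM : 0 < δ / (4 * B * M) := by positivity
  refine lt_of_mul_lt_mul_right ?_ hδM.le
  calc γ * (δ / (4 * B * M)) = γ / M * (δ / (4 * B)) := by field_simp
    _ < γ / M * S := by gcongr
    _ ≤ Λ * (d + β * M * δ / A) := hcmp
    _ ≤ Λ * (√δ + β * M * δ / A) := by gcongr
    _ = Λ * (δ / √δ + β * M * δ / A) := by rw [Real.div_sqrt]
    _ = 4 * M * Λ * B * (1 / √δ + β * M / A) * (δ / (4 * B * M)) := by field_simp

theorem lt_of_sqrt_lt_dist {A M β γ δ Λ d S : ℝ} (hA : 0 < A) (hM : 0 < M) (hβ : 0 < β)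
    (hγ : 0 < γ) (hδ : 0 < δ) (hdS : d ≤ β * S) (hcmp : γ / M * S ≤ Λ * (d + β * M * δ / A))
    (hΛ : Λ ≤ γ * (1 / (M * β) - √δ / (4 * A))) (hd : √δ < d) : γ < 4 * M * Λ * β := by
  have hsqrt : 0 < √δ := Real.sqrt_pos.2 hδ
  have hdist : γ / (M * β) * d ≤ Λ * (d + β * M * δ / A) :=
    calc γ / (M * β) * d ≤ γ / (M * β) * (β * S) := by gcongr
      _ = γ / M * S := by field_simp
      _ ≤ _ := hcmp
  have hslack := mul_le_mul_of_nonneg_right hΛ (hsqrt.trans hd).le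
  refine lt_of_mul_lt_mul_right ?_ (by positivity : 0 ≤ δ / (4 * A))
  calc γ * (δ / (4 * A)) = γ * (√δ / (4 * A)) * √δ := by
        nth_rw 1 [← Real.mul_self_sqrt hδ.le]
        ring
    _ < γ * (√δ / (4 * A)) * d := by gcongr
    _ = γ / (M * β) * d - γ * (1 / (M * β) - √δ / (4 * A)) * d := by ring
    _ ≤ Λ * (β * M * δ / A) := by linarith
    _ = 4 * M * Λ * β * (δ / (4 * A)) := by ring

variable {n m : ℕ} {f : E n → ℝ} {a : Fin m → E n} {b : Fin m → ℝ} {β γ δ ε κ μ L Λ r d S : ℝ}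
  {x z : E n}

theorem sum_penalty_le_of_mem_penSolutions (hf : HasQuadraticBounds f (gradient f) μ L)
    (hμ : 0 ≤ μ) (hx : x ∈ penSolutions f a b γ δ) (hz : ∀ i, penalty δ (a i) (b i) z = 0)
    (hΛ : ‖gradient f z‖ ≤ Λ) (hxz : ‖x - z‖ ≤ r) :
    γ / m * ∑ i, penalty δ (a i) (b i) x ≤ Λ * r := by
  have hmin := hx z
  have hconvex := gradient_mem_subdiff hf hμ z x
  have hinner := neg_le_of_abs_le (abs_real_inner_le_norm (gradient f z) (x - z))
  have hprod : ‖gradient f z‖ * ‖x - z‖ ≤ Λ * r :=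
    mul_le_mul hΛ hxz (norm_nonneg _) ((norm_nonneg _).trans hΛ)
  simp only [penObj, hz, Finset.sum_const_zero, mul_zero, add_zero] at hmin
  linarith

theorem sqrt_div_lt [NeZero m] (ha : ∀ i, a i ≠ 0) (hβ : 0 < β)
    (hδ : δ < 16 * alphaMin a ^ 2 / (β ^ 2 * m ^ 2)) : √δ / (4 * alphaMin a) < 1 / (m * β) := by
  have hA := alphaMin_pos ha
  have hm : (0 : ℝ) < m := by exact_mod_cast NeZero.pos m
  rw [div_lt_iff₀ (by positivity), Real.sqrt_lt' (by positivity)]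
  exact hδ.trans_eq (by field_simp; ring)

theorem lt_Gam [NeZero m] (ha : ∀ i, a i ≠ 0) (hβ : 0 < β) (hγ : 0 < γ) (hδ : 0 < δ)
    (hδβ : δ < 16 * alphaMin a ^ 2 / (β ^ 2 * m ^ 2)) (hΛ : 0 ≤ Λ) (hdS : d ≤ β * S)
    (hS : δ / (4 * alphaMax a) < S)
    (hcmp : γ / m * S ≤ Λ * (d + β * m * δ / alphaMin a)) : γ < Gam a β δ Λ := by
  have hA := alphaMin_pos ha
  have hB := alphaMax_pos ha
  have hm : (1 : ℝ) ≤ m := by exact_mod_cast NeZero.one_le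
  have hm0 : (0 : ℝ) < m := by linarith
  rcases le_or_gt d √δ with hd | hd
  · exact lt_max_of_lt_right (lt_of_dist_le_sqrt hB hm0 hγ hδ hΛ hS hcmp hd)
  · by_contra! hle
    have hΛγ := (le_max_left _ _).trans hle
    rw [← div_eq_mul_inv, div_le_iff₀ (sub_pos.2 (sqrt_div_lt ha hβ hδβ))] at hΛγ
    have hAB : alphaMin a ≤ alphaMax a := (alphaMin_le a 0).trans (le_alphaMax a 0)
    have hβB : β ≤ alphaMax a * (1 / √δ + β * m / alphaMin a) :=
      calc β = alphaMin a * (β * 1 / alphaMin a) := by field_simp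
        _ ≤ alphaMax a * (β * m / alphaMin a) := by gcongr
        _ ≤ _ := by
          gcongr
          exact le_add_of_nonneg_left (by positivity)
    refine hle.not_gt (lt_max_of_lt_right ?_)
    calc γ < 4 * m * Λ * β := lt_of_sqrt_lt_dist hA hm0 hβ hγ hδ hdS hcmp hΛγ hd
      _ ≤ 4 * m * Λ * (alphaMax a * (1 / √δ + β * m / alphaMin a)) := by gcongr
      _ = _ := by ring

theorem penSolutions_subset_feasible [NeZero m] (ha : ∀ i, a i ≠ 0)
    (hint : ∃ x : E n, ∀ i, inner ℝ (a i) x - b i ≤ -ε) (hβ : IsHoffmanConst a β)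
    (hf : HasQuadraticBounds f (gradient f) μ L) (hμ : 0 ≤ μ) (hL : 0 < L)
    (hadm : AdmissibleParams f a b β ε κ γ δ) : penSolutions f a b γ δ ⊆ feasible a b := by
  obtain ⟨hγ, hδ, hδlt, hγκ, c, R, hκc, hR, hΓ⟩ := hadm
  obtain ⟨hδε, hδβ⟩ := lt_min_iff.1 hδlt
  have hintδ : ∃ x : E n, ∀ i, inner ℝ (a i) x - b i ≤ -δ :=
    hint.imp fun x hx i => (hx i).trans (neg_le_neg hδε.le)
  have hne : (feasible a b).Nonempty :=
    hintδ.imp fun x hx => mem_feasible.2 fun i => (hx i).trans (neg_nonpos.2 hδ.le)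
  intro x hx
  by_contra hxX
  obtain ⟨hp, hpdist⟩ := proj_spec (isClosed_feasible a b) hne x
  obtain ⟨z, hzX, hz, hpz⟩ := hβ.exists_unpenalized_near ha hintδ hδ hp
  have hxz : ‖x - z‖ ≤ ‖x - proj (feasible a b) x‖ + β * m * δ / alphaMin a :=
    (norm_sub_le_norm_sub_add_norm_sub x (proj (feasible a b) x) z).trans (by gcongr)
  have hγδ : γ * δ ≤ c := ((le_div_iff₀ hδ).1 hγκ).trans hκc.le
  have hzR : ‖z‖ ≤ R := (hR γ δ hγ hδ hδε.le hγδ x hx).2 hxX z hzX hz hxz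
  have hcmp := sum_penalty_le_of_mem_penSolutions hf hμ hx hz
    (norm_gradient_le_subgradBound hf hμ hL hzR) hxz
  exact hΓ.not_gt (lt_Gam ha hβ.1 hγ hδ hδβ (subgradBound_nonneg f R)
    (hpdist.trans_le (hβ.infDist_feasible_le_sum_penalty ha hδ hne x))
    (lt_sum_penalty_of_notMem_feasible ha hδ hxX) hcmp)

end Exactness

section PenalizedMinimizers

variable {n m : ℕ} {f : E n → ℝ} {a : Fin m → E n} {b : Fin m → ℝ} {μ L γ δ δ₀ : ℝ} {z : E n}

theorem penObj_add_norm_sub_sq_le [NeZero m] (hf : HasQuadraticBounds f (gradient f) μ L)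
    (hμ : 0 ≤ μ) (ha : ∀ i, a i ≠ 0) (hγ : 0 ≤ γ) (hδ : 0 < δ) (hz : z ∈ penSolutions f a b γ δ)
    {x : E n} (hx : x ∈ feasible a b) :
    penObj f a b γ δ z + μ / 2 * ‖z - x‖ ^ 2 ≤ f x + γ * δ / (4 * alphaMin a) := by
  have hgrowth := (hasQuadraticBounds_penObj hf ha b hγ hδ).lower z x
  rw [bregman, mean_compGrad_eq_zero hf hμ ha hγ hδ hz, inner_zero_left, sub_zero,
    norm_sub_rev] at hgrowth
  have hfeas := penObj_le_of_mem_feasible f ha hγ hδ hx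
  rw [← mul_div_assoc] at hfeas
  linarith

theorem norm_sub_sq_le_of_mem_penSolutions [NeZero m]
    (hf : HasQuadraticBounds f (gradient f) μ L) (hμ : 0 < μ) (ha : ∀ i, a i ≠ 0) (hγ : 0 ≤ γ)
    (hδ : 0 < δ) (hγδ : γ ≤ 2 * μ * alphaMin a * δ₀ / δ) (hz : z ∈ penSolutions f a b γ δ)
    (hzX : z ∈ feasible a b) {x : E n} (hx : x ∈ feasible a b) (hmin : IsMinOn f (feasible a b) x) :
    ‖z - x‖ ^ 2 ≤ δ₀ := by
  have hA := alphaMin_pos ha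
  have hgap := penObj_add_norm_sub_sq_le hf hμ.le ha hγ hδ hz hx
  have hpen : γ * δ / (4 * alphaMin a) ≤ μ / 2 * δ₀ := by
    rw [div_le_iff₀ (by positivity)]
    linarith [(le_div_iff₀ hδ).1 hγδ]
  have hfz : f x ≤ penObj f a b γ δ z := (hmin hzX).trans (le_penObj f a b hγ hδ z)
  exact le_of_mul_le_mul_left (by linarith) (half_pos hμ)

theorem penObj_sub_le_sInf [NeZero m] (ha : ∀ i, a i ≠ 0) (hγ : 0 ≤ γ) (hδ : 0 < δ)
    (hγδ : γ ≤ 4 * alphaMin a * δ₀ / δ) (hz : z ∈ penSolutions f a b γ δ)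
    (hzX : z ∈ feasible a b) : penObj f a b γ δ z - δ₀ ≤ sInf (f '' feasible a b) := by
  have hA := alphaMin_pos ha
  have hpen : γ * (δ / (4 * alphaMin a)) ≤ δ₀ := by
    rw [← mul_div_assoc, div_le_iff₀ (by positivity)]
    linarith [(le_div_iff₀ hδ).1 hγδ]
  refine le_csInf ⟨f z, z, hzX, rfl⟩ ?_
  rintro _ ⟨x, hx, rfl⟩
  linarith [hz x, penObj_le_of_mem_feasible f ha hγ hδ hx]

theorem bddBelow_range_of_isBounded_sublevel {X : Type*} [PseudoMetricSpace X] [ProperSpace X]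
    {f : X → ℝ} (hf : Continuous f) (hlev : ∀ r : ℝ, Bornology.IsBounded {x | f x ≤ r}) :
    BddBelow (Set.range f) := by
  rcases isEmpty_or_nonempty X with _ | ⟨⟨x₀⟩⟩
  · simp only [Set.range_eq_empty, bddBelow_empty]
  · obtain ⟨w, hw⟩ := hf.exists_forall_le_of_isBounded x₀ (hlev _)
    exact ⟨f w, Set.forall_mem_range.2 hw⟩

/-- Off the minimizers of `F`, the function `f` falls below `r` only at the expense of a
proportional gap of `F`: this turns a bound on an expected gap of `F` into a lower bound on the
expectation of `f`. -/
theorem exists_sub_mul_gap_le {X : Type*} [TopologicalSpace X] {f F : X → ℝ} (hf : Continuous f)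
    (hF : Continuous F) {r : ℝ} (hr : IsCompact {x | f x ≤ r}) {z : X} (hz : ∀ y, F z ≤ F y)
    (hmin : ∀ x, (∀ y, F x ≤ F y) → r < f x) :
    ∃ K : ℝ, 0 ≤ K ∧ ∀ x, r - K * (F x - F z) ≤ f x := by
  obtain ⟨l, hl⟩ := hr.bddBelow_image hf.continuousOn
  have hFz : ∀ x ∈ {x | f x ≤ r}, F z < F x := fun x hx => by
    by_contra! hle
    exact (hmin x fun y => hle.trans (hz y)).not_ge hx
  obtain ⟨c, hc, hcF⟩ := hr.exists_forall_le' hF.continuousOn hFz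
  have hc' : 0 < c - F z := sub_pos.2 hc
  refine ⟨|r - l| / (c - F z), by positivity, fun x => ?_⟩
  rcases le_or_gt (f x) r with hx | hx
  · have hlx : l ≤ f x := hl ⟨x, hx, rfl⟩
    calc r - |r - l| / (c - F z) * (F x - F z)
        ≤ r - |r - l| / (c - F z) * (c - F z) := by
          have := hcF x hx
          gcongr
      _ = r - |r - l| := by rw [div_mul_cancel₀ _ hc'.ne']
      _ ≤ f x := by linarith [le_abs_self (r - l)]
  · have : 0 ≤ |r - l| / (c - F z) * (F x - F z) :=
      mul_nonneg (by positivity) (sub_nonneg.2 (hz x))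
    linarith

end PenalizedMinimizers

section Convergence

variable {n m : ℕ} {Ω : Type*} [MeasurableSpace Ω] {P : Measure Ω}
  [IsProbabilityMeasure P] {J : ℕ → Ω → Fin m} (hJ : IsUniformSampling P J)
  {f : E n → ℝ} {a : Fin m → E n} {b : Fin m → ℝ} {μ L γ δ α : ℝ} {z : E n}

include hJ

theorem integrable_iter (f : E n → ℝ) (a : Fin m → E n) (b : Fin m → ℝ) (γ δ α : ℝ) (x0 : E n)
    (t : ℕ) (Ψ : E n → ℝ) :
    Integrable (fun ω => Ψ (iter f a b γ δ α x0 (fun k => J k ω) t)) P :=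
  integrable_sagaState hJ (compGrad f a b γ δ) α x0 t fun s => Ψ s.1

theorem integrable_avgIter (f : E n → ℝ) (a : Fin m → E n) (b : Fin m → ℝ) (γ δ α : ℝ)
    (x0 : E n) (t : ℕ) (Ψ : E n → ℝ) :
    Integrable (fun ω => Ψ (avgIter f a b γ δ α x0 (fun k => J k ω) t)) P := by
  refine integrable_comp_of_dependsOn (s := Finset.range t)
    (Ψ := fun j => Ψ (avgIter f a b γ δ α x0 j t)) hJ.measurable fun j j' hj => ?_
  have hiter : ∀ k ∈ Finset.Icc 1 t, iter f a b γ δ α x0 j k = iter f a b γ δ α x0 j' k :=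
    fun k hk => congrArg Prod.fst (dependsOn_sagaState _ α x0 k fun l hl =>
      hj l (Finset.range_mono (Finset.mem_Icc.1 hk).2 hl))
  simp only [avgIter, Finset.sum_congr rfl hiter]

theorem exists_integral_norm_iter_sub_sq_le_mul_pow [NeZero m]
    (hf : HasQuadraticBounds f (gradient f) μ L) (hμ : 0 < μ) (ha : ∀ i, a i ≠ 0) (hγ : 0 < γ)
    (hδ : 0 < δ) (hα : α = 1 / (2 * (μ * m + L + γ * alphaMax a / (2 * δ))))
    (hz : z ∈ penSolutions f a b γ δ) (x0 : E n) :
    ∃ C : ℝ, ∀ t : ℕ,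
      ∫ ω, ‖iter f a b γ δ α x0 (fun k => J k ω) t - z‖ ^ 2 ∂P ≤ C * (1 - α * μ) ^ t := by
  have hB := alphaMax_pos ha
  have hμL : μ < L + γ * alphaMax a / (2 * δ) :=
    lt_add_of_le_of_pos (hf.le_of_ne (ha 0)) (by positivity)
  exact exists_integral_norm_sagaState_sub_sq_le_mul_pow hJ
    (hasQuadraticBounds_add_penalty hf ha b hγ.le hδ) hμ hμL (by rw [hα, add_assoc])
    (mean_compGrad_eq_zero hf hμ.le ha hγ.le hδ hz) x0

theorem exists_integral_gap_avgIter_le_div [NeZero m]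
    (hf : HasQuadraticBounds f (gradient f) 0 L) (hL : 0 < L) (ha : ∀ i, a i ≠ 0) (hγ : 0 ≤ γ)
    (hδ : 0 < δ) (hα : α = 1 / (3 * (L + γ * alphaMax a / (2 * δ))))
    (hz : z ∈ penSolutions f a b γ δ) (x0 : E n) : ∃ C : ℝ, ∀ t : ℕ, 1 ≤ t →
      ∫ ω, (penObj f a b γ δ (avgIter f a b γ δ α x0 (fun k => J k ω) t) -
        penObj f a b γ δ z) ∂P ≤ C / t := by
  have hB := alphaMax_pos ha
  obtain ⟨C, hC⟩ := exists_sum_integral_gap_sagaState_le hJ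
    (hasQuadraticBounds_add_penalty hf ha b hγ hδ) (by positivity) hα
    (mean_compGrad_eq_zero hf le_rfl ha hγ hδ hz) x0
  simp only [mean_add_penalty] at hC
  refine ⟨C, fun t ht => ?_⟩
  let gap (x : E n) : ℝ := penObj f a b γ δ x - penObj f a b γ δ z
  let x (ω : Ω) (k : ℕ) : E n := iter f a b γ δ α x0 (fun k => J k ω) k
  have hint (k : ℕ) : Integrable (fun ω => gap (x ω k)) P :=
    integrable_iter hJ f a b γ δ α x0 k gap
  have : Nonempty (Finset.Icc 1 t) := ⟨1, Finset.left_mem_Icc.2 ht⟩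
  have hjensen (ω : Ω) : gap (avgIter f a b γ δ α x0 (fun k => J k ω) t) ≤
      mean fun k : Finset.Icc 1 t => gap (x ω k) := by
    rw [avgIter, ← mean_Icc, mean_sub, mean_const]
    exact sub_le_sub_right ((hasQuadraticBounds_penObj hf ha b hγ hδ).map_mean_le le_rfl _) _
  calc ∫ ω, gap (avgIter f a b γ δ α x0 (fun k => J k ω) t) ∂P
      ≤ ∫ ω, mean (fun k : Finset.Icc 1 t => gap (x ω k)) ∂P :=
        integral_mono (integrable_avgIter hJ f a b γ δ α x0 t gap)
          (integrable_mean fun k : Finset.Icc 1 t => hint k) hjensen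
    _ = 1 / (t : ℝ) * ∑ k ∈ Finset.Icc 1 t, ∫ ω, gap (x ω k) ∂P := by
        rw [integral_mean fun k : Finset.Icc 1 t => hint k,
          mean_Icc fun k => ∫ ω, gap (x ω k) ∂P, smul_eq_mul]
    _ ≤ 1 / (t : ℝ) * ∑ k ∈ Finset.range (t + 1), ∫ ω, gap (x ω k) ∂P := by
        gcongr
        · exact fun k _ _ => integral_nonneg fun ω => sub_nonneg.2 (hz _)
        · exact fun k hk => Finset.mem_range_succ_iff.2 (Finset.mem_Icc.1 hk).2
    _ ≤ 1 / (t : ℝ) * C := mul_le_mul_of_nonneg_left (hC (t + 1)) (by positivity)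
    _ = C / t := one_div_mul_eq_div _ _

theorem integral_norm_iter_sub_proj_sq_le (hz : z ∈ feasible a b) (x0 : E n) (t : ℕ) :
    ∫ ω, ‖iter f a b γ δ α x0 (fun k => J k ω) t -
        proj (feasible a b) (iter f a b γ δ α x0 (fun k => J k ω) t)‖ ^ 2 ∂P ≤
      ∫ ω, ‖iter f a b γ δ α x0 (fun k => J k ω) t - z‖ ^ 2 ∂P :=
  integral_mono (integrable_iter hJ f a b γ δ α x0 t fun y => ‖y - proj (feasible a b) y‖ ^ 2)
    (integrable_iter hJ f a b γ δ α x0 t fun y => ‖y - z‖ ^ 2) fun _ =>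
      pow_le_pow_left₀ (norm_nonneg _) (norm_sub_proj_le (isClosed_feasible a b) hz _) 2

theorem integral_norm_iter_sub_sq_le (z x x0 : E n) (t : ℕ) :
    ∫ ω, ‖iter f a b γ δ α x0 (fun k => J k ω) t - x‖ ^ 2 ∂P ≤
      2 * ∫ ω, ‖iter f a b γ δ α x0 (fun k => J k ω) t - z‖ ^ 2 ∂P + 2 * ‖z - x‖ ^ 2 := by
  have hint (p : E n) := integrable_iter hJ f a b γ δ α x0 t fun y => ‖y - p‖ ^ 2
  have hpt (y : E n) : ‖y - x‖ ^ 2 ≤ 2 * ‖y - z‖ ^ 2 + 2 * ‖z - x‖ ^ 2 := by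
    have h := norm_sub_sq_le_of_pos one_pos (y - z) (x - z)
    rw [sub_sub_sub_cancel_right, norm_sub_rev x] at h
    linarith
  calc _ ≤ ∫ ω, (2 * ‖iter f a b γ δ α x0 (fun k => J k ω) t - z‖ ^ 2 + 2 * ‖z - x‖ ^ 2) ∂P :=
        integral_mono (hint x) (((hint z).const_mul 2).add (integrable_const _)) fun _ => hpt _
    _ = _ := by
        rw [integral_add ((hint z).const_mul 2) (integrable_const _), integral_const_mul]
        simp only [integral_const, probReal_univ, one_smul]

theorem integral_avgIter_le_add_integral_gap (hγ : 0 ≤ γ) (hδ : 0 < δ) (z x0 : E n) (t : ℕ) :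
    ∫ ω, f (avgIter f a b γ δ α x0 (fun k => J k ω) t) ∂P ≤ penObj f a b γ δ z +
      ∫ ω, (penObj f a b γ δ (avgIter f a b γ δ α x0 (fun k => J k ω) t) -
        penObj f a b γ δ z) ∂P := by
  have hint := integrable_avgIter hJ f a b γ δ α x0 t
  rw [integral_sub (hint _) (integrable_const _), integral_const, probReal_univ, one_smul,
    add_sub_cancel]
  exact integral_mono (hint f) (hint _) fun _ => le_penObj f a b hγ hδ _

theorem exists_forall_sub_le_integral_avgIter {x0 : E n} {C v η : ℝ}
    (hf : Continuous f) (hF : Continuous (penObj f a b γ δ))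
    (hlev : ∀ r : ℝ, Bornology.IsBounded {x | f x ≤ r}) (hz : z ∈ penSolutions f a b γ δ)
    (hv : ∀ x ∈ penSolutions f a b γ δ, v ≤ f x) (hC : ∀ t : ℕ, 1 ≤ t →
      ∫ ω, (penObj f a b γ δ (avgIter f a b γ δ α x0 (fun k => J k ω) t) -
        penObj f a b γ δ z) ∂P ≤ C / t) (hη : 0 < η) :
    ∃ T : ℕ, ∀ t : ℕ, T < t →
      v - η ≤ ∫ ω, f (avgIter f a b γ δ α x0 (fun k => J k ω) t) ∂P := by
  obtain ⟨K, hK, hgap⟩ := exists_sub_mul_gap_le hf hF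
    (Metric.isCompact_of_isClosed_isBounded (isClosed_le hf continuous_const) (hlev (v - η / 2)))
    hz fun x hx => by linarith [hv x hx]
  obtain ⟨T, hT⟩ := Filter.eventually_atTop.1
    ((tendsto_const_div_atTop_nhds_zero_nat (K * C)).eventually_le_const (half_pos hη))
  refine ⟨T, fun t ht => ?_⟩
  have hint := integrable_avgIter hJ f a b γ δ α x0 t
  calc v - η ≤ v - η / 2 - K * (C / t) := by
        have := hT t ht.le
        rw [mul_div_assoc] at this
        linarith
    _ ≤ v - η / 2 - K * ∫ ω, (penObj f a b γ δ (avgIter f a b γ δ α x0 (fun k => J k ω) t) -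
          penObj f a b γ δ z) ∂P := by
        gcongr
        exact hC t (Nat.one_le_of_lt ht)
    _ = ∫ ω, (v - η / 2 - K * (penObj f a b γ δ (avgIter f a b γ δ α x0 (fun k => J k ω) t) -
          penObj f a b γ δ z)) ∂P := by
        rw [integral_sub (integrable_const _) (hint fun y => K * (penObj f a b γ δ y - _)),
          integral_const_mul, integral_const, probReal_univ, one_smul]
    _ ≤ _ := integral_mono (hint fun y => v - η / 2 - K * (penObj f a b γ δ y - _)) (hint f)
        fun _ => hgap _

end Convergence

end PenSAGA

open PenSAGA in
theorem theorem4p2 {n m : ℕ} (hm : 0 < m)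
    (f : E n → ℝ) (a : Fin m → E n) (b : Fin m → ℝ) (ha : ∀ i, a i ≠ 0)
    (ε : ℝ) (hε : 0 < ε) (hint : ∃ x : E n, ∀ j, inner ℝ (a j) x - b j ≤ -ε)
    (β : ℝ) (hβ : IsHoffmanConst a β)
    (Lf : ℝ) (hLf : 0 < Lf) (hf : HasLipschitzGradient f Lf)
    (δ₀ : ℝ) (hδ₀ : 0 < δ₀) (γ δ : ℝ) (x0 : E n)
    {Ω : Type*} [MeasurableSpace Ω] (P : Measure Ω) [IsProbabilityMeasure P]
    (J : ℕ → Ω → Fin m) (hJ : IsUniformSampling P J) :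
    -- (a) strongly convex objective
    (∀ μf : ℝ, 0 < μf → StrongConvexOn Set.univ μf f →
      AdmissibleParams f a b β ε (2 * μf * alphaMin a * δ₀) γ δ →
      ∀ α q : ℝ, α = 1 / (2 * (μf * m + Lf + γ * alphaMax a / (2 * δ))) →
        q = 1 - μf / (2 * (μf * m + Lf + γ * alphaMax a / (2 * δ))) →
        (∃ C : ℝ, ∀ t : ℕ,
          ∫ ω, ‖iter f a b γ δ α x0 (fun k => J k ω) t -
              proj (feasible a b) (iter f a b γ δ α x0 (fun k => J k ω) t)‖ ^ 2 ∂P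
            ≤ C * q ^ t) ∧
        ∀ xs ∈ feasible a b, IsMinOn f (feasible a b) xs →
          ∃ C : ℝ, ∀ t : ℕ,
            ∫ ω, ‖iter f a b γ δ α x0 (fun k => J k ω) t - xs‖ ^ 2 ∂P
              ≤ C * q ^ t + 2 * δ₀) ∧
    -- (b) convex objective with bounded level sets
    (ConvexOn ℝ Set.univ f → (∀ r : ℝ, Bornology.IsBounded {x | f x ≤ r}) →
      AdmissibleParams f a b β ε (4 * alphaMin a * δ₀) γ δ →
      ∀ α : ℝ, α = 1 / (3 * (Lf + γ * alphaMax a / (2 * δ))) →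
        (∃ C : ℝ, ∀ t : ℕ, 1 ≤ t →
          ∫ ω, f (avgIter f a b γ δ α x0 (fun k => J k ω) t) ∂P - sInf (f '' feasible a b)
            ≤ C * (4 * m / t) + 2 * δ₀) ∧
        ∀ η : ℝ, 0 < η → ∃ T : ℕ, ∀ t : ℕ, T < t →
          -(γ * η) ≤
            ∫ ω, f (avgIter f a b γ δ α x0 (fun k => J k ω) t) ∂P -
              sInf (f '' feasible a b)) := by
  have : NeZero m := ⟨hm.ne'⟩
  refine ⟨fun μ hμ hconv hadm α q hα hq => ?_, fun hconv hlev hadm α hα => ?_⟩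
  · have hQ := hf.hasQuadraticBounds hconv
    have hX := penSolutions_subset_feasible ha hint hβ hQ hμ.le hLf hadm
    obtain ⟨hγ, hδ, -, hγδ, -⟩ := hadm
    obtain ⟨z, hz⟩ := penSolutions_nonempty hQ hμ.le (hQ.isBounded_sublevel hμ) ha b hγ.le hδ
    obtain rfl : q = 1 - α * μ := by rw [hq, hα]; ring
    obtain ⟨C, hC⟩ := exists_integral_norm_iter_sub_sq_le_mul_pow hJ hQ hμ ha hγ hδ hα hz x0
    refine ⟨⟨C, fun t => (integral_norm_iter_sub_proj_sq_le hJ (hX hz) x0 t).trans (hC t)⟩,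
      fun xs hxs hmin => ⟨2 * C, fun t => (integral_norm_iter_sub_sq_le hJ z xs x0 t).trans ?_⟩⟩
    linarith [hC t, norm_sub_sq_le_of_mem_penSolutions hQ hμ ha hγ.le hδ hγδ hz (hX hz) hxs hmin]
  · have hQ := hf.hasQuadraticBounds (strongConvexOn_zero.2 hconv)
    have hcont := hQ.continuous le_rfl
    have hX := penSolutions_subset_feasible ha hint hβ hQ le_rfl hLf hadm
    obtain ⟨hγ, hδ, -, hγδ, -⟩ := hadm
    obtain ⟨z, hz⟩ := penSolutions_nonempty hQ le_rfl hlev ha b hγ.le hδ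
    obtain ⟨C, hC⟩ := exists_integral_gap_avgIter_le_div hJ hQ hLf ha hγ.le hδ hα hz x0
    refine ⟨⟨C / (4 * m), fun t ht => ?_⟩, fun η hη => ?_⟩
    · rw [div_mul_div_cancel₀ (by positivity)]
      refine (sub_le_sub_right (integral_avgIter_le_add_integral_gap hJ hγ.le hδ z x0 t) _).trans ?_
      linarith [hC t ht, penObj_sub_le_sInf ha hγ.le hδ hγδ hz (hX hz)]
    · have hbdd := (bddBelow_range_of_isBounded_sublevel hcont hlev).mono
        (Set.image_subset_range f (feasible a b))
      have hcontF := (hasQuadraticBounds_penObj hQ ha b hγ.le hδ).continuous le_rfl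
      obtain ⟨T, hT⟩ := exists_forall_sub_le_integral_avgIter hJ hcont hcontF hlev hz
        (fun x hx => csInf_le hbdd ⟨x, hX hx, rfl⟩) hC (mul_pos hγ hη)
      exact ⟨T, fun t ht => by linarith [hT t ht]⟩
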